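/- Let $\Lambda,K,\tilde a,a_1>0$, and write $\|\cdot\|$ for the norm of $L^2(0,\Lambda)$. Let $\mathcal V=\{v\in H^1(0,\Lambda): v(\Lambda)=0\}$ and $$\kappa(u,v)=\Lambda^2K\int_0^\Lambda \partial_yu\,\partial_yv\,dy+\frac{\Lambda K\tilde a}{2a_1}\,u(0)v(0)\qquad(u,v\in\mathcal V).$$ For a $C^1$ function $L_0:\mathbb R\to\mathbb R$ (the prescribed length of the active arm) and $\ell_0\in L^2(0,\Lambda)$, a weak solution of the heat equation $\partial_t\ell=\Lambda^2K\,\partial_{yy}\ell$ on $(0,\Lambda)$ with the Fourier condition $\Lambda^2K\,\partial_y\ell(0,t)-\frac{\Lambda K\tilde a}{2a_1}\ell(0,t)=\frac{\Lambda}{2}\dot L_0(t)$ and the Dirichlet condition $\ell(\Lambda,t)=0$ is a function $\ell$ that for every $T>0$ lies in $L^\infty(0,T;L^2(0,\Lambda))\cap L^2(0,T;\mathcal V)$, is weakly continuous in time (that is, $t\mapsto\int_0^\Lambda\ell(y,t)v(y)\,dy$ is continuous on $[0,\infty)$ for every $v\in\mathcal V$, with $\ell(t)\in L^2(0,\Lambda)$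 for every $t\ge0$), satisfies $$\frac{d}{dt}\int_0^\Lambda \ell\,v\,dy+\kappa(\ell(t),v)=-\frac{\Lambda}{2}\dot L_0(t)\,v(0)\qquad\text{for all }v\in\mathcal V$$ in the sense of distributions on $(0,T)$, and $\ell(0)=\ell_0$. For an integer $N\ge1$ put $h=\Lambda/N$ and $y_j=(j-1)h$ for $1\le j\le N+1$. Let $\mathcal V_h\subset\mathcal V$ be the space of continuous functions that are affine on each $[y_j,y_{j+1}]$ and vanish at $\Lambda$, with hat basis $\Phi_1,\dots,\Phi_N$, $\Phi_j(y_k)=\delta_{jk}$. Consider the mass-lumped system $$\frac{d(\widetilde M_hL_h)}{dt}+K_hL_h=\tilde f(t)\quad(t>0),\qquad L_h=(\ell_1,\dots,\ell_N)^T,$$ where $\widetilde M_h=h\,\mathrm{Id}$, $(K_h)_{ij}=\kappa(\Phi_i,\Phi_j)$, $\tilde f=(-\frac\Lambda2\dot L_0,0,\dots,0)^T$, and $L_h$ is continuous on $[0,\infty)$. (1) Functions $\ell_1,\dots,\ell_N$ continuous on $[0,\infty)$ satisfy, with $\ell_{N+1}=0$, the equations of the $N$-spring swimmer $$h\dot\ell_1=\Lambda^2K\frac{\ell_2-\ell_1}{h}-\frac{\Lambda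 K\tilde a}{2a_1}\ell_1-\frac\Lambda2\dot L_0,\qquad \dot\ell_j=\Lambda^2K\frac{\ell_{j-1}-2\ell_j+\ell_{j+1}}{h^2}\quad(2\le j\le N)$$ for all $t>0$ if and only if $L_h$ solves the mass-lumped system. (2) There is a constant $C>0$, depending only on $\Lambda,K,\tilde a,a_1$, such that the following holds for every $C^1$ function $L_0$ and every $N\ge1$. Let $\ell$ be a weak solution with $\ell_0\in H^2(0,\Lambda)$, let $L_h$ solve the mass-lumped system, and let $\ell_h(t)=\sum_{j=1}^N\ell_j(t)\Phi_j\in\mathcal V_h$ and $\ell_{0,h}=\ell_h(0)$. Then for all $t\ge0$ $$\|\ell_h(t)-\ell(t)\|\le C\|\ell_{0,h}-\ell_0\|+Ch^2\big(\|\partial_{yy}\ell_0\|+\|\partial_{yy}\ell(t)\|\big)+Ch\Big(\int_0^t\|\partial_{yt}\ell(s)\|^2\,ds\Big)^{1/2}.$$ Here $\partial_{yy}\ell(t)$ and $\partial_{yt}\ell$ are the (locally integrable) weak derivatives of $\ell(t)$ on $(0,\Lambda)$ and of $\ell$ on $(0,\Lambda)\times(0,t)$, and the right-hand side counts as $+\infty$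 if one of them is not square integrable. -/

import Mathlib

open MeasureTheory Set
open scoped ENNReal NNReal ContDiff Matrix

noncomputable section

namespace Swimmer

/-! ### Sobolev functions on the interval `(0, Λ)` -/

/-- Lebesgue measure on `(0, Λ)`. -/
def dom (Λ : ℝ) : Measure ℝ := volume.restrict (Ioo 0 Λ)

/-- The norm of `L²(0, Λ)`, with value `∞` when `u` is not square integrable. -/
def normL2 (Λ : ℝ) (u : ℝ → ℝ) : ℝ≥0∞ := eLpNorm u 2 (dom Λ)

/-- `g` is the `n`-th weak derivative of `u` on `(0, Λ)`. -/
structure HasWeakDeriv (Λ : ℝ) (n : ℕ) (u g : ℝ → ℝ) : Prop where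
  locInt : LocallyIntegrableOn u (Ioo 0 Λ) volume
  locInt_deriv : LocallyIntegrableOn g (Ioo 0 Λ) volume
  integral_eq : ∀ φ : ℝ → ℝ, ContDiff ℝ ∞ φ → HasCompactSupport φ → tsupport φ ⊆ Ioo 0 Λ →
    ∫ y, u y * iteratedDeriv n φ y ∂(dom Λ) = (-1) ^ n * ∫ y, g y * φ y ∂(dom Λ)

/-- `u ∈ H^k(0, Λ)`: the weak derivatives of orders `0, …, k` exist in `L²(0, Λ)`. -/
def MemH (Λ : ℝ) (k : ℕ) (u : ℝ → ℝ) : Prop :=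
  ∀ j ≤ k, ∃ g : ℝ → ℝ, HasWeakDeriv Λ j u g ∧ MemLp g 2 (dom Λ)

/-- `v`, with weak derivative `dv`, is (the continuous representative of) an element of
`𝒱 = {v ∈ H¹(0, Λ) : v(Λ) = 0}`. -/
structure MemV (Λ : ℝ) (v dv : ℝ → ℝ) : Prop where
  continuousOn : ContinuousOn v (Icc 0 Λ)
  weakDeriv : HasWeakDeriv Λ 1 v dv
  memLp : MemLp dv 2 (dom Λ)
  dirichlet : v Λ = 0

/-- The bilinear form `κ(u, v) = Λ² K ∫₀^Λ ∂_y u ∂_y v dy + (Λ K ã / (2 a₁)) u(0) v(0)`, where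
`du`, `dv` are the derivatives of `u`, `v`. -/
def kappa (Λ K a a₁ : ℝ) (u du v dv : ℝ → ℝ) : ℝ :=
  Λ ^ 2 * K * ∫ y, du y * dv y ∂(dom Λ) + Λ * K * a / (2 * a₁) * (u 0 * v 0)

/-! ### The continuous problem -/

/-- `ℓ ∈ L^∞(0,T; L²(0,Λ)) ∩ L²(0,T; 𝒱)`, with space derivative `dℓ`, solves
`d/dt ∫ ℓ v dy + κ(ℓ, v) = -(Λ/2) L₀'(t) v(0)` for all `v ∈ 𝒱`, the time derivative being taken in
the sense of distributions on `(0, T)`, with `ℓ(0) = ℓ₀`. Here `ℓ t` is the function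
`y ↦ ℓ(y, t)`. The field `weakCont` selects, among the functions that are equal for almost every
`t`, the one that is weakly continuous in time: this gives a meaning to `ℓ(t)` for every `t` and to
the initial condition. -/
structure IsWeakSolutionWith (Λ K a a₁ T : ℝ) (L₀ ℓ₀ : ℝ → ℝ) (ℓ dℓ : ℝ → ℝ → ℝ) : Prop where
  meas : AEStronglyMeasurable (Function.uncurry ℓ) ((volume.restrict (Ioo 0 T)).prod (dom Λ))
  meas_deriv :
    AEStronglyMeasurable (Function.uncurry dℓ) ((volume.restrict (Ioo 0 T)).prod (dom Λ))
  memLp : ∀ t ∈ Ico 0 T, MemLp (ℓ t) 2 (dom Λ)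
  bounded : ∃ M : ℝ≥0, ∀ᵐ t ∂(volume.restrict (Ioo 0 T)), normL2 Λ (ℓ t) ≤ M
  memV : ∀ᵐ t ∂(volume.restrict (Ioo 0 T)), MemV Λ (ℓ t) (dℓ t)
  sqIntegrable : ∫⁻ t in Ioo 0 T, normL2 Λ (dℓ t) ^ 2 < ⊤
  weakCont : ∀ v dv : ℝ → ℝ, MemV Λ v dv →
    ContinuousOn (fun t => ∫ y, ℓ t y * v y ∂(dom Λ)) (Ico 0 T)
  equation : ∀ v dv : ℝ → ℝ, MemV Λ v dv →
    ∀ φ : ℝ → ℝ, ContDiff ℝ ∞ φ → HasCompactSupport φ → tsupport φ ⊆ Ioo 0 T →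
      -(∫ t in Ioo 0 T, deriv φ t * ∫ y, ℓ t y * v y ∂(dom Λ))
        + ∫ t in Ioo 0 T, φ t * kappa Λ K a a₁ (ℓ t) (dℓ t) v dv
      = ∫ t in Ioo 0 T, φ t * (-(Λ / 2) * deriv L₀ t * v 0)
  initial : ℓ 0 =ᵐ[dom Λ] ℓ₀

/-- `ℓ` is a weak solution on the time interval `(0, T)` with initial value `ℓ₀`. -/
def IsWeakSolution (Λ K a a₁ T : ℝ) (L₀ ℓ₀ : ℝ → ℝ) (ℓ : ℝ → ℝ → ℝ) : Prop :=
  ∃ dℓ : ℝ → ℝ → ℝ, IsWeakSolutionWith Λ K a a₁ T L₀ ℓ₀ ℓ dℓ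

/-- `w` is the mixed weak derivative `∂_{yt} ℓ` on `(0, t) × (0, Λ)` (time comes first). -/
structure HasMixedWeakDeriv (Λ t : ℝ) (ℓ w : ℝ → ℝ → ℝ) : Prop where
  locInt : LocallyIntegrableOn (Function.uncurry ℓ) (Ioo 0 t ×ˢ Ioo 0 Λ) volume
  locInt_deriv : LocallyIntegrableOn (Function.uncurry w) (Ioo 0 t ×ˢ Ioo 0 Λ) volume
  integral_eq : ∀ φ : ℝ × ℝ → ℝ, ContDiff ℝ ∞ φ → HasCompactSupport φ →
    tsupport φ ⊆ Ioo 0 t ×ˢ Ioo 0 Λ →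
      ∫ p in Ioo 0 t ×ˢ Ioo 0 Λ, ℓ p.1 p.2 * deriv (fun s => deriv (fun y => φ (s, y)) p.2) p.1
        = ∫ p in Ioo 0 t ×ˢ Ioo 0 Λ, w p.1 p.2 * φ p

/-! ### The discrete problem -/

/-- The mesh size `h = Λ / N`. -/
def mesh (Λ : ℝ) (N : ℕ) : ℝ := Λ / N

/-- The hat function attached to the node `i h`, for `i = 0, …, N - 1`. -/
def hat (Λ : ℝ) (N : ℕ) (i : Fin N) (y : ℝ) : ℝ :=
  max 0 (1 - |y - (i : ℝ) * mesh Λ N| / mesh Λ N)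

/-- The element of the P1 finite element space `𝒱_h` with nodal values `c` (and `0` at `Λ`). -/
def p1 (Λ : ℝ) (N : ℕ) (c : Fin N → ℝ) (y : ℝ) : ℝ := ∑ i, c i * hat Λ N i y

/-- The stiffness matrix `κ(Φ_i, Φ_j)`. -/
def stiffness (Λ K a a₁ : ℝ) (N : ℕ) : Matrix (Fin N) (Fin N) ℝ :=
  Matrix.of fun i j =>
    kappa Λ K a a₁ (hat Λ N i) (deriv (hat Λ N i)) (hat Λ N j) (deriv (hat Λ N j))

/-- The non-standard lumped mass matrix: `h` at every diagonal entry, the first one included. -/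
def lumpedMass (Λ : ℝ) (N : ℕ) : Matrix (Fin N) (Fin N) ℝ :=
  Matrix.diagonal fun _ => mesh Λ N

/-- The load vector `(-(Λ/2) L₀'(t), 0, …, 0)`. -/
def load (Λ : ℝ) (N : ℕ) (L₀ : ℝ → ℝ) (t : ℝ) : Fin N → ℝ :=
  fun i => if (i : ℕ) = 0 then -(Λ / 2) * deriv L₀ t else 0

/-- The mass-lumped finite element system `d(M̃_h c)/dt + K_h c = f̃` for the nodal values `c`. -/
structure IsLumpedSolution (Λ K a a₁ : ℝ) (N : ℕ) (L₀ : ℝ → ℝ) (c : ℝ → Fin N → ℝ) : Prop where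
  continuousOn : ContinuousOn c (Ici 0)
  ode : ∀ t > 0, HasDerivAt (fun s => lumpedMass Λ N *ᵥ c s)
    (load Λ N L₀ t - stiffness Λ K a a₁ N *ᵥ c t) t

/-- The equations of the `N`-spring swimmer for the elongations `x 1, …, x N`, with the fictitious
variable `x (N + 1) = 0`. -/
structure IsSpringSolution (Λ K a a₁ : ℝ) (N : ℕ) (L₀ : ℝ → ℝ) (x : ℕ → ℝ → ℝ) : Prop where
  continuousOn : ∀ j, 1 ≤ j → j ≤ N → ContinuousOn (x j) (Ici 0)
  first : ∀ t > 0, HasDerivAt (fun s => mesh Λ N * x 1 s)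
    (Λ ^ 2 * K * ((x 2 t - x 1 t) / mesh Λ N) - Λ * K * a / (2 * a₁) * x 1 t
      - Λ / 2 * deriv L₀ t) t
  inner : ∀ j, 2 ≤ j → j ≤ N → ∀ t > 0, HasDerivAt (x j)
    (Λ ^ 2 * K * ((x (j - 1) t - 2 * x j t + x (j + 1) t) / mesh Λ N ^ 2)) t
  last : ∀ t ≥ 0, x (N + 1) t = 0

end Swimmer

end

/-! A hat function has constant slope on each cell, so `κ(u, Φ_i)` sees only the nodal values of
`u`: it is a second difference, one-sided at `0` and completed there by the Fourier term. Read on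
the rows of `K_h`, this is part (1).

Read on the exact solution (`kappa_hat`), it says that nodal interpolation is the Ritz projection in
dimension one: `κ(ℓ, Φ_i)` is the stiffness matrix applied to the nodal values of `ℓ`. Let `θ` be
the nodal values of `ℓ_h - ℓ` and `m = ∂_t ℓ`. Subtracting the two problems gives `h θ_i' + (K_h
θ)_i = ∫ m Φ_i - h m(y_i)`, so mass lumping is the only source of error. Multiplied by `θ_i` and
summed, the right side is the error of the left rectangle rule on `m θ_h`, the first node carrying
the full weight `h`. It is at most `2h ‖∂_y m‖_{L¹} Σ |θ_{j+1} - θ_j|`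
(`abs_integral_mul_p1_sub_le`). Young's inequality absorbs the differences into the dissipation `θ ·
K_h θ` and leaves `(h²/K) ‖∂_{yt} ℓ‖²` (`consistency_sub_dissipation_le`). Integration in time gives
`energy_estimate`; no Gronwall argument enters, so the constant does not depend on `t`. The way back
to `L²` norms is the equivalence of `h Σ θ_i²` with `‖θ_h‖²` and the interpolation bound
`integral_sub_p1_sq_le`, used at the times `0` and `t`.

The remaining work is regularity, since `ℓ` is known only through distributional identities. An
integrable mixed derivative `w` forces `ℓ(s) = ℓ(0) + increment` for every `s`
(`IsWeakSolutionWith.eq_add_increment`). Hence nodal values are absolutely continuous in time, and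
the weak formulation tested with a hat function holds pointwise for almost every time
(`IsWeakSolutionWith.ae_hat_equation`). `HasPrimitive`, absolute continuity in integral form, is the
common language in `y` and in `t`. -/

namespace Swimmer

/-! ### Primitives of integrable functions -/

/-- On `[a, b]`, the function `F` is a primitive of the integrable function `f`. -/
structure HasPrimitive (a b : ℝ) (F f : ℝ → ℝ) : Prop where
  int : IntervalIntegrable f volume a b
  eq : ∀ x ∈ Icc a b, F x = F a + ∫ y in a..x, f y

namespace HasPrimitive

variable {a b : ℝ} {F f G g : ℝ → ℝ}

theorem int_mono (hF : HasPrimitive a b F f) {x y : ℝ} (hx : x ∈ Icc a b) (hy : y ∈ Icc a b) :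
    IntervalIntegrable f volume x y :=
  hF.int.mono_set (by
    rw [uIcc_of_le (hx.1.trans hx.2)]
    exact uIcc_subset_Icc hx hy)

theorem sub_eq (hF : HasPrimitive a b F f) {x y : ℝ} (hx : x ∈ Icc a b) (hy : y ∈ Icc a b) :
    F y - F x = ∫ z in x..y, f z := by
  have ha : a ∈ Icc a b := ⟨le_rfl, hx.1.trans hx.2⟩
  rw [hF.eq x hx, hF.eq y hy, ← intervalIntegral.integral_add_adjacent_intervals
    (hF.int_mono ha hx) (hF.int_mono hx hy)]
  ring

theorem continuousOn (hab : a ≤ b) (hF : HasPrimitive a b F f) : ContinuousOn F (Icc a b) := by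
  have h : ContinuousOn (fun x => F a + ∫ y in a..x, f y) (Icc a b) := by
    refine continuousOn_const.add ?_
    have := intervalIntegral.continuousOn_primitive_interval'
      (μ := volume) (f := f) (a := a) hF.int left_mem_uIcc
    rwa [uIcc_of_le hab] at this
  exact h.congr hF.eq

theorem of_integral (hf : IntervalIntegrable f volume a b) (c : ℝ) :
    HasPrimitive a b (fun x => c + ∫ y in a..x, f y) f :=
  ⟨hf, fun x _ => by simp⟩

theorem of_hasDerivAt (hab : a ≤ b) (h : ∀ x ∈ Icc a b, HasDerivAt F (f x) x)
    (hf : ContinuousOn f (Icc a b)) : HasPrimitive a b F f := by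
  refine ⟨(hf.mono (by rw [uIcc_of_le hab])).intervalIntegrable, fun x hx => ?_⟩
  have hs : uIcc a x ⊆ Icc a b := by
    rw [uIcc_of_le hx.1]; exact Icc_subset_Icc_right hx.2
  rw [intervalIntegral.integral_eq_sub_of_hasDerivAt (fun y hy => h y (hs hy))
    ((hf.mono hs).intervalIntegrable)]
  ring

theorem of_contDiff (hab : a ≤ b) (h : ContDiff ℝ ∞ F) : HasPrimitive a b F (deriv F) :=
  of_hasDerivAt hab (fun x _ => (h.differentiable (by simp) x).hasDerivAt)
    (h.continuous_deriv (by simp)).continuousOn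

theorem congr_left (hab : a ≤ b) (hF : HasPrimitive a b F f) (h : EqOn G F (Icc a b)) :
    HasPrimitive a b G f :=
  ⟨hF.int, fun x hx => by rw [h hx, h ⟨le_rfl, hab⟩, hF.eq x hx]⟩

theorem sub (hF : HasPrimitive a b F f) (hG : HasPrimitive a b G g) :
    HasPrimitive a b (fun x => F x - G x) (fun x => f x - g x) := by
  refine ⟨hF.int.sub hG.int, fun x hx => ?_⟩
  have ha : a ∈ Icc a b := ⟨le_rfl, hx.1.trans hx.2⟩
  rw [intervalIntegral.integral_sub (hF.int_mono ha hx) (hG.int_mono ha hx), hF.eq x hx,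
    hG.eq x hx]
  ring

theorem integrable_mul (hab : a ≤ b) (hF : HasPrimitive a b F f)
    (hg : IntervalIntegrable g volume a b) :
    IntervalIntegrable (fun x => F x * g x) volume a b :=
  hg.continuousOn_mul (by rw [uIcc_of_le hab]; exact hF.continuousOn hab)

/-- Integration by parts holds for the absolutely continuous functions `∫ f` and `∫ g`, whose
derivatives are `f` and `g` almost everywhere by Lebesgue differentiation; the constants `F a` and
`G a` are then put back. -/
theorem integral_mul (hab : a ≤ b) (hF : HasPrimitive a b F f) (hG : HasPrimitive a b G g) :
    ∫ x in a..b, F x * g x = F b * G b - F a * G a - ∫ x in a..b, f x * G x := by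
  have hFc := hF.int.absolutelyContinuousOnInterval_intervalIntegral (c := a) left_mem_uIcc
  have hGc := hG.int.absolutelyContinuousOnInterval_intervalIntegral (c := a) left_mem_uIcc
  have key := hFc.integral_mul_deriv_eq_deriv_mul hGc
  have h1 : ∫ x in a..b, (∫ v in a..x, f v) * deriv (fun x => ∫ v in a..x, g v) x
      = ∫ x in a..b, (F x - F a) * g x := by
    apply intervalIntegral.integral_congr_ae
    filter_upwards [hG.int.ae_hasDerivAt_integral] with x hx hxab
    rw [(hx (uIoc_subset_uIcc hxab) a left_mem_uIcc).deriv, hF.eq x, add_sub_cancel_left]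
    rw [← uIcc_of_le hab]; exact uIoc_subset_uIcc hxab
  have h2 : ∫ x in a..b, deriv (fun x => ∫ v in a..x, f v) x * (∫ v in a..x, g v)
      = ∫ x in a..b, f x * (G x - G a) := by
    apply intervalIntegral.integral_congr_ae
    filter_upwards [hF.int.ae_hasDerivAt_integral] with x hx hxab
    rw [(hx (uIoc_subset_uIcc hxab) a left_mem_uIcc).deriv, hG.eq x, add_sub_cancel_left]
    rw [← uIcc_of_le hab]; exact uIoc_subset_uIcc hxab
  have hb : b ∈ Icc a b := ⟨hab, le_rfl⟩
  have e1 : ∫ x in a..b, (F x - F a) * g x = (∫ x in a..b, F x * g x) - F a * ∫ x in a..b, g x := by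
    simp_rw [sub_mul]
    rw [intervalIntegral.integral_sub (hF.integrable_mul hab hG.int) (hG.int.const_mul _),
      intervalIntegral.integral_const_mul]
  have e2 : ∫ x in a..b, f x * (G x - G a) = (∫ x in a..b, f x * G x) - (∫ x in a..b, f x) * G a := by
    simp_rw [mul_sub]
    rw [intervalIntegral.integral_sub _ (hF.int.mul_const _),
      intervalIntegral.integral_mul_const]
    simpa only [mul_comm] using hG.integrable_mul hab hF.int
  rw [h1, h2, e1, e2, intervalIntegral.integral_same] at key
  have eF := hF.eq b hb
  have eG := hG.eq b hb
  rw [eF, eG]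
  linear_combination key

theorem abs_sub_le (hab : a ≤ b) (hF : HasPrimitive a b F f) {x y : ℝ} (hx : x ∈ Icc a b)
    (hy : y ∈ Icc a b) : |F y - F x| ≤ ∫ z in a..b, |f z| := by
  rw [hF.sub_eq hx hy]
  have h1 := intervalIntegral.norm_integral_le_integral_norm_uIoc (f := f) (μ := volume)
    (a := x) (b := y)
  refine h1.trans ?_
  rw [intervalIntegral.integral_of_le hab]
  refine setIntegral_mono_set ?_ (Filter.Eventually.of_forall fun _ => abs_nonneg _) ?_
  · have := hF.int.norm
    rwa [intervalIntegrable_iff_integrableOn_Ioc_of_le hab] at this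
  · refine LE.le.eventuallyLE ?_
    exact Ioc_subset_Ioc (le_min hx.1 hy.1) (max_le hx.2 hy.2)

end HasPrimitive

/-! ### Integrals over `(0, Λ)` -/

theorem integral_dom {Λ : ℝ} (hΛ : 0 ≤ Λ) (f : ℝ → ℝ) :
    ∫ y, f y ∂(dom Λ) = ∫ y in (0 : ℝ)..Λ, f y := by
  rw [intervalIntegral.integral_of_le hΛ, integral_Ioc_eq_integral_Ioo]; rfl

theorem integrable_dom_iff {Λ : ℝ} (hΛ : 0 ≤ Λ) {f : ℝ → ℝ} :
    Integrable f (dom Λ) ↔ IntervalIntegrable f volume 0 Λ := by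
  rw [intervalIntegrable_iff_integrableOn_Ioo_of_le hΛ]; rfl

instance (Λ : ℝ) : IsFiniteMeasure (dom Λ) := by unfold dom; infer_instance

theorem MemLp.integrable_dom {Λ : ℝ} {f : ℝ → ℝ} (hf : MemLp f 2 (dom Λ)) :
    Integrable f (dom Λ) := hf.integrable (by norm_num)

/-! ### Test functions and the lemma of du Bois-Reymond -/

/-- Smooth functions with compact support in `(0, Λ)`. -/
structure IsTest (Λ : ℝ) (φ : ℝ → ℝ) : Prop where
  smooth : ContDiff ℝ ∞ φ
  compact : HasCompactSupport φ
  supp : tsupport φ ⊆ Ioo 0 Λ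

namespace IsTest

variable {Λ : ℝ} {φ ψ : ℝ → ℝ}

theorem eq_zero (hφ : IsTest Λ φ) {x : ℝ} (hx : x ∉ Ioo 0 Λ) : φ x = 0 :=
  image_eq_zero_of_notMem_tsupport fun h => hx (hφ.supp h)

theorem deriv (hφ : IsTest Λ φ) : IsTest Λ (deriv φ) :=
  ⟨hφ.smooth.iterate_deriv 1, hφ.compact.deriv, fun _ hx => hφ.supp (tsupport_deriv_subset hx)⟩

theorem sub_const_mul (hφ : IsTest Λ φ) (hψ : IsTest Λ ψ) (c : ℝ) :
    IsTest Λ (fun x => φ x - c * ψ x) := by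
  refine ⟨hφ.smooth.sub (contDiff_const.mul hψ.smooth), hφ.compact.sub hψ.compact.mul_left, ?_⟩
  refine (tsupport_sub _ _).trans (union_subset hφ.supp ?_)
  exact (tsupport_mul_subset_right).trans hψ.supp

theorem integrable_mul (hφ : IsTest Λ φ) {u : ℝ → ℝ}
    (hu : LocallyIntegrableOn u (Ioo 0 Λ) volume) : Integrable (fun x => u x * φ x) (dom Λ) := by
  have h := hu.integrableOn_compact_subset hφ.supp hφ.compact
  have h2 : IntegrableOn (fun x => u x * φ x) (tsupport φ) volume :=
    h.mul_continuousOn hφ.smooth.continuous.continuousOn hφ.compact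
  have h3 : Integrable (fun x => u x * φ x) volume := by
    rw [← integrableOn_iff_integrable_of_support_subset (s := tsupport φ)]
    · exact h2
    · exact (Function.support_mul_subset_right _ _).trans (subset_tsupport φ)
  exact h3.mono_measure Measure.restrict_le_self

theorem exists_integral_eq_one (hΛ : 0 < Λ) : ∃ ρ, IsTest Λ ρ ∧ ∫ x in (0 : ℝ)..Λ, ρ x = 1 := by
  let B : ContDiffBump (Λ / 2) := ⟨Λ / 8, Λ / 4, by positivity, by linarith⟩
  have hs : tsupport (B.normed volume) ⊆ Ioo 0 Λ := by
    rw [B.tsupport_normed_eq]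
    intro x hx
    rw [Metric.mem_closedBall, Real.dist_eq, abs_le] at hx
    change _ ≤ _ ∧ _ ≤ Λ / 4 at hx
    have h1 : -(Λ / 4) ≤ x - Λ / 2 := hx.1
    constructor <;> linarith [hx.2]
  refine ⟨B.normed volume, ⟨B.contDiff_normed, B.hasCompactSupport_normed, hs⟩, ?_⟩
  rw [← integral_dom hΛ.le, dom, setIntegral_eq_integral_of_forall_compl_eq_zero]
  · exact B.integral_normed
  · intro x hx
    exact image_eq_zero_of_notMem_tsupport fun h => hx (hs h)

/-- The primitive from `0` vanishes to the left of the support of `ψ`, and to its right because the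
mean of `ψ` is zero. -/
theorem exists_primitive (hΛ : 0 < Λ) (hψ : IsTest Λ ψ) (h0 : ∫ x in (0 : ℝ)..Λ, ψ x = 0) :
    ∃ φ, IsTest Λ φ ∧ _root_.deriv φ = ψ := by
  have hc := hψ.smooth.continuous
  have hd : ∀ x, HasDerivAt (fun x => ∫ y in (0 : ℝ)..x, ψ y) (ψ x) x := fun x =>
    intervalIntegral.integral_hasDerivAt_right (hc.intervalIntegrable _ _)
      (hc.stronglyMeasurableAtFilter _ _) hc.continuousAt
  have hderiv : _root_.deriv (fun x => ∫ y in (0 : ℝ)..x, ψ y) = ψ := funext fun x => (hd x).deriv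
  obtain ⟨a, b, ha, hb, hab⟩ : ∃ a b, 0 < a ∧ b < Λ ∧ tsupport ψ ⊆ Icc a b := by
    rcases (tsupport ψ).eq_empty_or_nonempty with he | hne
    -- For `ψ = 0` the endpoints are reversed, so that `Icc a b` is empty.
    · exact ⟨Λ, 0, hΛ, hΛ, by simp [he]⟩
    · obtain ⟨p, hp, hp'⟩ := hψ.compact.exists_isLeast hne
      obtain ⟨q, hq, hq'⟩ := hψ.compact.exists_isGreatest hne
      exact ⟨p, q, (hψ.supp hp).1, (hψ.supp hq).2, fun x hx => ⟨hp' hx, hq' hx⟩⟩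
  have hz : ∀ x, x ∉ Icc a b → ψ x = 0 := fun x hx =>
    image_eq_zero_of_notMem_tsupport fun h => hx (hab h)
  have hsupp : Function.support (fun x => ∫ y in (0 : ℝ)..x, ψ y) ⊆ Icc a b := by
    intro x hx
    by_contra hn
    apply hx
    rw [mem_Icc, not_and_or, not_le, not_le] at hn
    rcases hn with h | h
    · have : EqOn ψ (fun _ => 0) (uIcc 0 x) := fun y hy => hz y fun hy' => by
        rw [uIcc, mem_Icc] at hy
        have := hy.2.trans (max_le ha.le h.le)
        rcases max_choice 0 x with e | e <;> rw [e] at hy <;> linarith [hy'.1, hy.2]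
      change ∫ y in (0 : ℝ)..x, ψ y = 0
      rw [intervalIntegral.integral_congr this]; simp
    · have h1 := intervalIntegral.integral_add_adjacent_intervals
        (hc.intervalIntegrable (μ := volume) 0 x) (hc.intervalIntegrable x Λ)
      have : EqOn ψ (fun _ => 0) (uIcc x Λ) := fun y hy => hz y fun hy' => by
        have := (le_min h.le hb.le).trans hy.1
        rw [uIcc, mem_Icc] at hy
        rcases min_choice x Λ with e | e <;> rw [e] at hy <;> linarith [hy'.2, hy.1]
      rw [h0, intervalIntegral.integral_congr this] at h1
      change ∫ y in (0 : ℝ)..x, ψ y = 0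
      simpa using h1
  have hts : tsupport (fun x => ∫ y in (0 : ℝ)..x, ψ y) ⊆ Icc a b :=
    closure_minimal hsupp isClosed_Icc
  refine ⟨_, ⟨?_, ?_, hts.trans fun x hx => ⟨ha.trans_le hx.1, hx.2.trans_lt hb⟩⟩, hderiv⟩
  · rw [contDiff_infty_iff_deriv, hderiv]
    exact ⟨fun x => (hd x).differentiableAt, hψ.smooth⟩
  · exact HasCompactSupport.of_support_subset_isCompact isCompact_Icc hsupp

end IsTest

theorem IsTest.exists_primitive_sub {Λ : ℝ} (hΛ : 0 < Λ) {φ ρ : ℝ → ℝ} (hφ : IsTest Λ φ)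
    (hρ : IsTest Λ ρ) (hρ1 : ∫ x in (0 : ℝ)..Λ, ρ x = 1) :
    ∃ χ, IsTest Λ χ ∧ _root_.deriv χ = fun x => φ x - (∫ x in (0 : ℝ)..Λ, φ x) * ρ x := by
  refine (hφ.sub_const_mul hρ _).exists_primitive hΛ ?_
  rw [intervalIntegral.integral_sub (hφ.smooth.continuous.intervalIntegrable _ _)
    ((hρ.smooth.continuous.intervalIntegrable _ _).const_mul _),
    intervalIntegral.integral_const_mul, hρ1]
  ring

/-- For a fixed `ρ` of integral one, `g - (∫ g) ρ` has mean zero and is therefore the derivative of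
a test function. The hypothesis then says that `u - ∫ u ρ` is orthogonal to every test function `g`.
-/
theorem ae_eq_const_of_integral_deriv_eq_zero {Λ : ℝ} (hΛ : 0 < Λ) {u : ℝ → ℝ}
    (hu : LocallyIntegrableOn u (Ioo 0 Λ) volume)
    (h : ∀ φ, IsTest Λ φ → ∫ x, u x * deriv φ x ∂(dom Λ) = 0) :
    ∃ c, ∀ᵐ x ∂(dom Λ), u x = c := by
  obtain ⟨ρ, hρ, hρ1⟩ := IsTest.exists_integral_eq_one hΛ
  refine ⟨∫ x, u x * ρ x ∂(dom Λ), ?_⟩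
  have hloc : LocallyIntegrableOn (fun x => u x - ∫ x, u x * ρ x ∂(dom Λ)) (Ioo 0 Λ) volume :=
    hu.sub ((locallyIntegrable_const _).locallyIntegrableOn _)
  have key := isOpen_Ioo.ae_eq_zero_of_integral_contDiff_smul_eq_zero (μ := volume) hloc ?_
  · rw [dom, ae_restrict_iff' measurableSet_Ioo]
    filter_upwards [key] with x hx hxm
    exact sub_eq_zero.1 (hx hxm)
  · intro g hg hgc hgs
    have ht : IsTest Λ g := ⟨hg, hgc, hgs⟩
    obtain ⟨φ, hφ, hφ'⟩ := ht.exists_primitive_sub hΛ hρ hρ1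
    have h1 := h φ hφ
    rw [hφ'] at h1
    have h2 : ∫ x, g x • (u x - ∫ x, u x * ρ x ∂(dom Λ)) =
        ∫ x, (u x * g x - (∫ x, u x * ρ x ∂(dom Λ)) * g x) ∂(dom Λ) := by
      rw [← setIntegral_eq_integral_of_forall_compl_eq_zero (s := Ioo 0 Λ)]
      · change ∫ x, _ ∂(dom Λ) = _
        congr 1; ext x; simp only [smul_eq_mul]; ring
      · intro x hx; rw [ht.eq_zero hx, zero_smul]
    have hgi : Integrable g (dom Λ) :=
      (integrable_dom_iff hΛ.le).2 (hg.continuous.intervalIntegrable _ _)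
    have h3 : ∫ x, u x * (g x - (∫ x in (0 : ℝ)..Λ, g x) * ρ x) ∂(dom Λ)
        = (∫ x, u x * g x ∂(dom Λ)) - (∫ x in (0 : ℝ)..Λ, g x) * ∫ x, u x * ρ x ∂(dom Λ) := by
      rw [← integral_const_mul, ← integral_sub (ht.integrable_mul hu)
        ((hρ.integrable_mul hu).const_mul _)]
      congr 1; ext x; ring
    rw [h2, integral_sub (ht.integrable_mul hu) (hgi.const_mul _), integral_const_mul,
      integral_dom hΛ.le g]
    linarith [h3.symm.trans h1]

theorem locallyIntegrableOn_of_integrable_dom {Λ : ℝ} {f : ℝ → ℝ} (hf : Integrable f (dom Λ)) :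
    LocallyIntegrableOn f (Ioo 0 Λ) volume :=
  IntegrableOn.locallyIntegrableOn hf

theorem HasPrimitive.integral_mul_deriv_test {Λ : ℝ} (hΛ : 0 < Λ) {F f φ : ℝ → ℝ}
    (hF : HasPrimitive 0 Λ F f) (hφ : IsTest Λ φ) :
    ∫ x, F x * deriv φ x ∂(dom Λ) = -∫ x, f x * φ x ∂(dom Λ) := by
  rw [integral_dom hΛ.le, integral_dom hΛ.le,
    hF.integral_mul hΛ.le (HasPrimitive.of_contDiff hΛ.le hφ.smooth),
    hφ.eq_zero (x := 0) (by simp), hφ.eq_zero (x := Λ) (by simp)]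
  ring

theorem HasPrimitive.integrable_dom {Λ : ℝ} (hΛ : 0 < Λ) {F f : ℝ → ℝ}
    (hF : HasPrimitive 0 Λ F f) : Integrable F (dom Λ) := by
  rw [integrable_dom_iff hΛ.le]
  refine ContinuousOn.intervalIntegrable ?_
  rw [uIcc_of_le hΛ.le]
  exact hF.continuousOn hΛ.le

/-- A function with an integrable weak derivative has an absolutely continuous representative. -/
theorem exists_hasPrimitive_of_weak_deriv {Λ : ℝ} (hΛ : 0 < Λ) {u g : ℝ → ℝ}
    (hu : LocallyIntegrableOn u (Ioo 0 Λ) volume) (hg : Integrable g (dom Λ))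
    (h : ∀ φ, IsTest Λ φ → ∫ x, u x * deriv φ x ∂(dom Λ) = -∫ x, g x * φ x ∂(dom Λ)) :
    ∃ U, HasPrimitive 0 Λ U g ∧ u =ᵐ[dom Λ] U := by
  have hG := HasPrimitive.of_integral ((integrable_dom_iff hΛ.le).1 hg) 0
  have hGl := locallyIntegrableOn_of_integrable_dom (hG.integrable_dom hΛ)
  obtain ⟨c, hc⟩ := ae_eq_const_of_integral_deriv_eq_zero hΛ (hu.sub hGl) (by
    intro φ hφ
    have h1 := h φ hφ
    rw [← hG.integral_mul_deriv_test hΛ hφ] at h1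
    simp only [Pi.sub_apply, sub_mul]
    rw [integral_sub (hφ.deriv.integrable_mul hu) (hφ.deriv.integrable_mul hGl), h1, sub_self])
  refine ⟨_, HasPrimitive.of_integral ((integrable_dom_iff hΛ.le).1 hg) c, ?_⟩
  filter_upwards [hc] with x hx
  simp only [Pi.sub_apply] at hx
  linarith

/-- A function with an integrable second weak derivative has a continuously differentiable
representative, whose derivative is absolutely continuous. -/
theorem HasWeakDeriv.exists_hasPrimitive_two {Λ : ℝ} (hΛ : 0 < Λ) {u g : ℝ → ℝ}
    (hu : HasWeakDeriv Λ 2 u g) (hg : Integrable g (dom Λ)) :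
    ∃ U V, HasPrimitive 0 Λ U V ∧ HasPrimitive 0 Λ V g ∧ u =ᵐ[dom Λ] U := by
  obtain ⟨ρ, hρ, hρ1⟩ := IsTest.exists_integral_eq_one hΛ
  have hV0 := HasPrimitive.of_integral ((integrable_dom_iff hΛ.le).1 hg) 0
  have hU0 := HasPrimitive.of_integral ((integrable_dom_iff hΛ.le).1 (hV0.integrable_dom hΛ)) 0
  set V0 : ℝ → ℝ := fun x => 0 + ∫ y in (0 : ℝ)..x, g y
  set U0 : ℝ → ℝ := fun x => 0 + ∫ y in (0 : ℝ)..x, V0 y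
  have hU0l := locallyIntegrableOn_of_integrable_dom (hU0.integrable_dom hΛ)
  -- No first weak derivative of `u` is given. Subtracting a double primitive of `g` leaves a
  -- function with zero second weak derivative; testing against primitives of `φ - (∫ φ) ρ` shows
  -- that its first weak derivative is the constant `b`.
  have key : ∀ φ, IsTest Λ φ → ∫ x, (u x - U0 x) * deriv (deriv φ) x ∂(dom Λ) = 0 := by
    intro φ hφ
    have h1 := hu.integral_eq φ hφ.smooth hφ.compact hφ.supp
    rw [show iteratedDeriv 2 φ = deriv (deriv φ) by
      rw [iteratedDeriv_succ, iteratedDeriv_one]] at h1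
    simp only [sub_mul]
    rw [integral_sub (hφ.deriv.deriv.integrable_mul hu.locInt)
      (hφ.deriv.deriv.integrable_mul hU0l), h1, hU0.integral_mul_deriv_test hΛ hφ.deriv,
      hV0.integral_mul_deriv_test hΛ hφ]
    ring
  set b := -∫ x, (u x - U0 x) * deriv ρ x ∂(dom Λ) with hb
  have hd := hu.locInt.sub hU0l
  obtain ⟨U, hU, hUe⟩ := exists_hasPrimitive_of_weak_deriv hΛ hd (integrable_const b) (by
    intro φ hφ
    obtain ⟨χ, hχ, hχ'⟩ := hφ.exists_primitive_sub hΛ hρ hρ1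
    have h1 := key χ hχ
    have h2 : deriv (deriv χ) = fun x => deriv φ x - (∫ x in (0 : ℝ)..Λ, φ x) * deriv ρ x := by
      rw [hχ']
      ext x
      rw [deriv_fun_sub (hφ.smooth.differentiable (by simp) x)
        ((hρ.smooth.differentiable (by simp) x).const_mul _),
        deriv_const_mul _ (hρ.smooth.differentiable (by simp) x)]
    rw [h2] at h1
    have h3 : ∫ x, (u x - U0 x) * (deriv φ x - (∫ x in (0 : ℝ)..Λ, φ x) * deriv ρ x) ∂(dom Λ)
        = (∫ x, (u x - U0 x) * deriv φ x ∂(dom Λ))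
          - (∫ x in (0 : ℝ)..Λ, φ x) * ∫ x, (u x - U0 x) * deriv ρ x ∂(dom Λ) := by
      rw [← integral_const_mul]
      refine Eq.trans ?_ (integral_sub (hφ.deriv.integrable_mul hd)
        ((hρ.deriv.integrable_mul hd).const_mul _))
      refine integral_congr_ae (.of_forall fun x => ?_)
      change _ = (u x - U0 x) * deriv φ x - _ * ((u x - U0 x) * deriv ρ x)
      ring
    rw [integral_const_mul, integral_dom hΛ.le φ]
    simp only [Pi.sub_apply]
    rw [hb]
    linarith [h3.symm.trans h1])
  refine ⟨fun x => U x - (-U0 x), fun x => b - (-V0 x), hU.sub ⟨hU0.int.neg, fun x hx => ?_⟩,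
    ⟨((integrable_dom_iff hΛ.le).1 hg), fun x hx => ?_⟩, ?_⟩
  · rw [hU0.eq x hx, intervalIntegral.integral_neg]; ring
  · rw [hV0.eq x hx]; ring
  · filter_upwards [hUe] with x hx
    simp only [Pi.sub_apply] at hx
    linarith

/-! ### Hat functions and the stiffness matrix -/

section Mesh

variable {Λ : ℝ} {N : ℕ}

theorem mesh_pos (hΛ : 0 < Λ) (hN : 1 ≤ N) : 0 < mesh Λ N :=
  div_pos hΛ (by exact_mod_cast hN)

theorem natCast_mul_mesh (hN : 1 ≤ N) : (N : ℝ) * mesh Λ N = Λ := by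
  have : (N : ℝ) ≠ 0 := by positivity
  unfold mesh; field_simp

theorem node_mem (hΛ : 0 < Λ) (hN : 1 ≤ N) {j : ℕ} (hj : j ≤ N) :
    (j : ℝ) * mesh Λ N ∈ Icc 0 Λ := by
  have h := mesh_pos hΛ hN
  refine ⟨by positivity, ?_⟩
  calc (j : ℝ) * mesh Λ N ≤ N * mesh Λ N := by gcongr
    _ = Λ := natCast_mul_mesh hN

theorem cell_subset (hΛ : 0 < Λ) (hN : 1 ≤ N) {j : ℕ} (hj : j < N) :
    Icc ((j : ℝ) * mesh Λ N) (((j + 1 : ℕ) : ℝ) * mesh Λ N) ⊆ Icc 0 Λ :=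
  Icc_subset_Icc (node_mem hΛ hN hj.le).1 (node_mem hΛ hN hj).2

theorem node_le (hΛ : 0 < Λ) (hN : 1 ≤ N) (j : ℕ) :
    (j : ℝ) * mesh Λ N ≤ ((j + 1 : ℕ) : ℝ) * mesh Λ N := by
  have h := mesh_pos hΛ hN
  push_cast; nlinarith

theorem integral_eq_sum_cells (hΛ : 0 < Λ) (hN : 1 ≤ N) {f : ℝ → ℝ}
    (hf : IntervalIntegrable f volume 0 Λ) :
    ∫ y in (0 : ℝ)..Λ, f y
      = ∑ j ∈ Finset.range N, ∫ y in (j : ℝ) * mesh Λ N..((j + 1 : ℕ) : ℝ) * mesh Λ N, f y := by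
  rw [intervalIntegral.sum_integral_adjacent_intervals]
  · rw [natCast_mul_mesh hN]; simp
  · intro k hk
    refine hf.mono_set ?_
    rw [uIcc_of_le (node_le hΛ hN k), uIcc_of_le hΛ.le]
    exact cell_subset hΛ hN hk

/-- In the cell coordinate `τ ∈ [0, 1]` the hat is `max 0 (1 - |j + τ - i|)`: it equals `1 - τ` for
`i = j`, `τ` for `i = j + 1`, and `0` otherwise. -/
theorem hat_cell (hΛ : 0 < Λ) (hN : 1 ≤ N) (i : Fin N) (j : ℕ) {y : ℝ}
    (hy : y ∈ Icc ((j : ℝ) * mesh Λ N) (((j + 1 : ℕ) : ℝ) * mesh Λ N)) :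
    hat Λ N i y = (if (i : ℕ) = j then 1 else 0) + (y - j * mesh Λ N) / mesh Λ N *
      ((if (i : ℕ) = j + 1 then 1 else 0) - if (i : ℕ) = j then 1 else 0) := by
  have h := mesh_pos hΛ hN
  set τ := (y - j * mesh Λ N) / mesh Λ N with hτ
  have hτ0 : 0 ≤ τ := div_nonneg (by linarith [hy.1]) h.le
  have hτ1 : τ ≤ 1 := by
    rw [hτ, div_le_one h]
    have := hy.2
    push_cast at this
    linarith
  have habs : |y - (i : ℝ) * mesh Λ N| / mesh Λ N = |(j : ℝ) + τ - i| := by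
    rw [← abs_of_pos h, ← abs_div, abs_of_pos h]
    congr 1
    rw [hτ]; field_simp; ring
  unfold hat
  rw [habs]
  rcases lt_trichotomy (i : ℕ) j with hij | hij | hij
  · have : ((i : ℕ) : ℝ) + 1 ≤ j := by exact_mod_cast hij
    rw [if_neg hij.ne, if_neg (by omega), abs_of_nonneg (by linarith), max_eq_left (by linarith)]
    ring
  · rw [if_pos hij, if_neg (by omega), hij, add_sub_cancel_left, abs_of_nonneg hτ0,
      max_eq_right (by linarith)]
    ring
  · rw [if_neg hij.ne']
    rcases eq_or_ne (i : ℕ) (j + 1) with e | e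
    · rw [if_pos e, e]
      push_cast
      rw [show (j : ℝ) + τ - (j + 1) = τ - 1 by ring, abs_of_nonpos (by linarith),
        max_eq_right (by linarith)]
      ring
    · rw [if_neg e]
      have : (j : ℝ) + 2 ≤ (i : ℕ) := by exact_mod_cast (show j + 2 ≤ (i : ℕ) by omega)
      rw [abs_of_nonpos (by linarith), max_eq_left (by linarith)]
      ring

theorem hat_node (hΛ : 0 < Λ) (hN : 1 ≤ N) (i : Fin N) (j : ℕ) :
    hat Λ N i (j * mesh Λ N) = if (i : ℕ) = j then 1 else 0 := by
  rw [hat_cell hΛ hN i j ⟨le_rfl, node_le hΛ hN j⟩]; simp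

theorem lipschitzWith_hat (hΛ : 0 < Λ) (hN : 1 ≤ N) (i : Fin N) :
    LipschitzWith (Real.toNNReal (mesh Λ N)⁻¹) (hat Λ N i) := by
  have h := mesh_pos hΛ hN
  refine LipschitzWith.of_dist_le_mul fun x y => ?_
  rw [Real.coe_toNNReal _ (by positivity), Real.dist_eq, Real.dist_eq]
  unfold hat
  refine (abs_max_sub_max_le_max _ _ _ _).trans ?_
  rw [sub_zero, abs_zero, max_eq_right (abs_nonneg _)]
  rw [show 1 - |x - (i : ℝ) * mesh Λ N| / mesh Λ N - (1 - |y - (i : ℝ) * mesh Λ N| / mesh Λ N)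
    = (mesh Λ N)⁻¹ * (|y - (i : ℝ) * mesh Λ N| - |x - (i : ℝ) * mesh Λ N|) by ring, abs_mul,
    abs_of_pos (inv_pos.2 h)]
  refine mul_le_mul_of_nonneg_left ?_ (inv_pos.2 h).le
  refine (abs_abs_sub_abs_le (y - (i : ℝ) * mesh Λ N) (x - (i : ℝ) * mesh Λ N)).trans ?_
  rw [abs_sub_comm x y]
  exact le_of_eq (by congr 1; ring)

/-- A Lipschitz function is absolutely continuous, hence the integral of its `deriv`; the values of
`deriv` at the kinks do not matter. -/
theorem hasPrimitive_hat (hΛ : 0 < Λ) (hN : 1 ≤ N) (i : Fin N) :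
    HasPrimitive 0 Λ (hat Λ N i) (deriv (hat Λ N i)) := by
  have hac : ∀ x, AbsolutelyContinuousOnInterval (hat Λ N i) 0 x := fun x =>
    ((lipschitzWith_hat hΛ hN i).lipschitzOnWith (s := uIcc 0 x)).absolutelyContinuousOnInterval
  exact ⟨(hac Λ).intervalIntegrable_deriv, fun x _ => by rw [(hac x).integral_deriv_eq_sub]; ring⟩

theorem HasPrimitive.hasWeakDeriv (hΛ : 0 < Λ) {F f : ℝ → ℝ} (hF : HasPrimitive 0 Λ F f) :
    HasWeakDeriv Λ 1 F f := by
  refine ⟨locallyIntegrableOn_of_integrable_dom (hF.integrable_dom hΛ),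
    locallyIntegrableOn_of_integrable_dom ((integrable_dom_iff hΛ.le).2 hF.int), ?_⟩
  intro φ h1 h2 h3
  rw [iteratedDeriv_one, hF.integral_mul_deriv_test hΛ ⟨h1, h2, h3⟩]
  ring

theorem HasPrimitive.memV (hΛ : 0 < Λ) {F f : ℝ → ℝ} (hF : HasPrimitive 0 Λ F f)
    (hf : MemLp f 2 (dom Λ)) (h0 : F Λ = 0) : MemV Λ F f :=
  ⟨hF.continuousOn hΛ.le, hF.hasWeakDeriv hΛ, hf, h0⟩

theorem memV_hat (hΛ : 0 < Λ) (hN : 1 ≤ N) (i : Fin N) :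
    MemV Λ (hat Λ N i) (deriv (hat Λ N i)) := by
  refine (hasPrimitive_hat hΛ hN i).memV hΛ ?_ ?_
  · exact MemLp.of_bound (measurable_deriv _).aestronglyMeasurable _
      (.of_forall fun x => norm_deriv_le_of_lipschitz (lipschitzWith_hat hΛ hN i))
  · have := hat_node hΛ hN i N
    rwa [natCast_mul_mesh hN, if_neg i.2.ne] at this

/-- The absolutely continuous representative agrees with `v` almost everywhere, and both are
continuous on `[0, Λ]`, so they agree up to the endpoints. This gives access to nodal values and
boundary values. -/
theorem MemV.hasPrimitive (hΛ : 0 < Λ) {v dv : ℝ → ℝ} (hv : MemV Λ v dv) :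
    HasPrimitive 0 Λ v dv := by
  obtain ⟨U, hU, he⟩ := exists_hasPrimitive_of_weak_deriv hΛ hv.weakDeriv.locInt
    (MemLp.integrable_dom hv.memLp) (by
      intro φ hφ
      have := hv.weakDeriv.integral_eq φ hφ.smooth hφ.compact hφ.supp
      rw [iteratedDeriv_one] at this
      rw [this]; ring)
  refine hU.congr_left hΛ.le (Measure.eqOn_Icc_of_ae_eq volume hΛ.ne ?_ hv.continuousOn
    (hU.continuousOn hΛ.le))
  rw [← restrict_Ioo_eq_restrict_Icc]
  exact he

theorem deriv_hat_cell (hΛ : 0 < Λ) (hN : 1 ≤ N) (i : Fin N) (j : ℕ) {y : ℝ}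
    (hy : y ∈ Ioo ((j : ℝ) * mesh Λ N) (((j + 1 : ℕ) : ℝ) * mesh Λ N)) :
    deriv (hat Λ N i) y =
      ((if (i : ℕ) = j + 1 then 1 else 0) - if (i : ℕ) = j then 1 else 0) / mesh Λ N := by
  set d : ℝ := (if (i : ℕ) = j + 1 then 1 else 0) - if (i : ℕ) = j then 1 else 0 with hd
  have h1 : HasDerivAt (fun y => (if (i : ℕ) = j then 1 else 0)
      + (y - j * mesh Λ N) / mesh Λ N * d) (1 / mesh Λ N * d) y :=
    ((((hasDerivAt_id y).sub_const _).div_const _).mul_const _).const_add _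
  have h2 : hat Λ N i =ᶠ[nhds y] fun y => (if (i : ℕ) = j then 1 else 0)
      + (y - j * mesh Λ N) / mesh Λ N * d := by
    filter_upwards [isOpen_Ioo.mem_nhds hy] with z hz
    exact hat_cell hΛ hN i j ⟨hz.1.le, hz.2.le⟩
  rw [(h1.congr_of_eventuallyEq h2).deriv]; ring

/-- The slope of the hat is constant on each cell, so each cell contributes a multiple of an
increment of `F`. For `i = 0` the truncated `i - 1` is again `0`, and the missing left cell
contributes `F 0 - F 0 = 0`. -/
theorem integral_mul_deriv_hat (hΛ : 0 < Λ) (hN : 1 ≤ N) (i : Fin N) {F f : ℝ → ℝ}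
    (hF : HasPrimitive 0 Λ F f) :
    ∫ y, f y * deriv (hat Λ N i) y ∂(dom Λ)
      = (2 * F ((i : ℕ) * mesh Λ N) - F (((i : ℕ) - 1 : ℕ) * mesh Λ N)
          - F (((i : ℕ) + 1 : ℕ) * mesh Λ N)) / mesh Λ N := by
  have hint : IntervalIntegrable (fun y => f y * deriv (hat Λ N i) y) volume 0 Λ := by
    rw [← integrable_dom_iff hΛ.le]
    refine ((integrable_dom_iff hΛ.le).2 hF.int).mul_bdd (measurable_deriv _).aestronglyMeasurable
      (.of_forall fun x => norm_deriv_le_of_lipschitz (lipschitzWith_hat hΛ hN i))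
  set D : ℕ → ℝ := fun j => F (((j + 1 : ℕ) : ℝ) * mesh Λ N) - F ((j : ℝ) * mesh Λ N) with hD
  have hcell : ∀ j ∈ Finset.range N,
      ∫ y in (j : ℝ) * mesh Λ N..((j + 1 : ℕ) : ℝ) * mesh Λ N, f y * deriv (hat Λ N i) y
        = D j * (((if (i : ℕ) = j + 1 then 1 else 0) - if (i : ℕ) = j then 1 else 0)
          / mesh Λ N) := by
    intro j hj
    have hj := Finset.mem_range.1 hj
    rw [hD]
    dsimp only
    rw [hF.sub_eq (node_mem hΛ hN hj.le) (node_mem hΛ hN hj),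
      ← intervalIntegral.integral_mul_const,
      intervalIntegral.integral_of_le (node_le hΛ hN j),
      intervalIntegral.integral_of_le (node_le hΛ hN j), integral_Ioc_eq_integral_Ioo,
      integral_Ioc_eq_integral_Ioo]
    refine setIntegral_congr_fun measurableSet_Ioo fun y hy => ?_
    rw [deriv_hat_cell hΛ hN i j hy]
  rw [integral_dom hΛ.le, integral_eq_sum_cells hΛ hN hint, Finset.sum_congr rfl hcell]
  have e1 : ∑ j ∈ Finset.range N, D j * (if (i : ℕ) = j then 1 else 0) = D i := by
    simp [Finset.sum_ite_eq]
  have e2 : ∑ j ∈ Finset.range N, D j * (if (i : ℕ) = j + 1 then 1 else 0)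
      = F ((i : ℕ) * mesh Λ N) - F (((i : ℕ) - 1 : ℕ) * mesh Λ N) := by
    rcases Nat.eq_zero_or_pos (i : ℕ) with h0 | h0
    · rw [h0]; simp
    · rw [Finset.sum_eq_single ((i : ℕ) - 1)]
      · rw [if_pos (by omega), hD]
        dsimp only
        rw [Nat.sub_add_cancel h0, mul_one]
      · intro j _ hj; rw [if_neg (by omega), mul_zero]
      · intro h; exact absurd (Finset.mem_range.2 (by omega)) h
  have : ∀ j, D j * (((if (i : ℕ) = j + 1 then 1 else 0) - if (i : ℕ) = j then 1 else 0)
      / mesh Λ N) = (D j * (if (i : ℕ) = j + 1 then 1 else 0)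
        - D j * (if (i : ℕ) = j then 1 else 0)) / mesh Λ N := fun j => by ring
  simp_rw [this]
  rw [← Finset.sum_div, Finset.sum_sub_distrib, e1, e2, hD]
  ring

/-- The nodal values, extended by zero. -/
noncomputable def nodal (c : Fin N → ℝ) (j : ℕ) : ℝ := if h : j < N then c ⟨j, h⟩ else 0

theorem nodal_fin (c : Fin N → ℝ) (i : Fin N) : nodal c i = c i := by simp [nodal]

theorem nodal_last (c : Fin N → ℝ) : nodal c N = 0 := by simp [nodal]

theorem sum_mul_ite (c : Fin N → ℝ) (j : ℕ) :
    ∑ i : Fin N, c i * (if (i : ℕ) = j then 1 else 0) = nodal c j := by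
  unfold nodal
  split_ifs with h
  · rw [Finset.sum_eq_single ⟨j, h⟩]
    · simp
    · intro i _ hi
      rw [if_neg (fun e => hi (Fin.ext e)), mul_zero]
    · simp
  · refine Finset.sum_eq_zero fun i _ => ?_
    rw [if_neg (by have := i.2; omega), mul_zero]

theorem p1_cell (hΛ : 0 < Λ) (hN : 1 ≤ N) (c : Fin N → ℝ) (j : ℕ) {y : ℝ}
    (hy : y ∈ Icc ((j : ℝ) * mesh Λ N) (((j + 1 : ℕ) : ℝ) * mesh Λ N)) :
    p1 Λ N c y = nodal c j + (y - j * mesh Λ N) / mesh Λ N * (nodal c (j + 1) - nodal c j) := by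
  unfold p1
  simp_rw [hat_cell hΛ hN _ j hy]
  rw [← sum_mul_ite c j, ← sum_mul_ite c (j + 1), ← Finset.sum_sub_distrib, Finset.mul_sum,
    ← Finset.sum_add_distrib]
  refine Finset.sum_congr rfl fun i _ => ?_
  ring

theorem continuous_hat (Λ : ℝ) (N : ℕ) (i : Fin N) : Continuous (hat Λ N i) := by
  unfold hat; fun_prop

theorem continuous_p1 (Λ : ℝ) (N : ℕ) (c : Fin N → ℝ) : Continuous (p1 Λ N c) := by
  unfold p1
  exact continuous_finsetSum _ fun i _ => continuous_const.mul (continuous_hat Λ N i)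

theorem kappa_comm (Λ K a a₁ : ℝ) (u du v dv : ℝ → ℝ) :
    kappa Λ K a a₁ u du v dv = kappa Λ K a a₁ v dv u du := by
  simp only [kappa, mul_comm]

/-- The action of the stiffness matrix on nodal values. -/
noncomputable def stiffApply (Λ K a a₁ : ℝ) (N : ℕ) (n : ℕ → ℝ) (i : ℕ) : ℝ :=
  Λ ^ 2 * K * ((2 * n i - n (i - 1) - n (i + 1)) / mesh Λ N)
    + Λ * K * a / (2 * a₁) * (n 0 * if i = 0 then 1 else 0)

/-- This is the Ritz property of nodal interpolation. It serves both to compute the stiffness matrix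
and to insert the exact solution into the scheme without error. -/
theorem kappa_hat (hΛ : 0 < Λ) (hN : 1 ≤ N) (K a a₁ : ℝ) {u du : ℝ → ℝ}
    (hu : HasPrimitive 0 Λ u du) (i : Fin N) :
    kappa Λ K a a₁ u du (hat Λ N i) (deriv (hat Λ N i))
      = stiffApply Λ K a a₁ N (fun j => u (j * mesh Λ N)) i := by
  have h0 := hat_node hΛ hN i 0
  simp only [Nat.cast_zero, zero_mul] at h0
  rw [kappa, integral_mul_deriv_hat hΛ hN i hu, stiffApply, h0]
  simp

theorem stiffness_mulVec (hΛ : 0 < Λ) (hN : 1 ≤ N) (K a a₁ : ℝ) (c : Fin N → ℝ) (i : Fin N) :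
    (stiffness Λ K a a₁ N *ᵥ c) i = stiffApply Λ K a a₁ N (nodal c) i := by
  have : ∀ j, stiffness Λ K a a₁ N i j
      = stiffApply Λ K a a₁ N (fun k => if (j : ℕ) = k then 1 else 0) i := fun j => by
    rw [stiffness, Matrix.of_apply, kappa_comm, kappa_hat hΛ hN K a a₁ (hasPrimitive_hat hΛ hN j)]
    simp_rw [hat_node hΛ hN]
  simp only [Matrix.mulVec, dotProduct, this, stiffApply, ← sum_mul_ite c, Finset.mul_sum,
    Finset.sum_mul, ← Finset.sum_sub_distrib, Finset.sum_div, ← Finset.sum_add_distrib]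
  refine Finset.sum_congr rfl fun j _ => ?_
  ring

/-- Summation by parts. The convention `0 - 1 = 0` provides the one-sided difference at the first
node; the boundary term at `k` disappears later because the last nodal value is zero. -/
theorem sum_mul_second_difference (n : ℕ → ℝ) (k : ℕ) :
    ∑ i ∈ Finset.range k, n i * (2 * n i - n (i - 1) - n (i + 1))
      = ∑ i ∈ Finset.range k, (n (i + 1) - n i) ^ 2 - n k * (n k - n (k - 1)) := by
  induction k with
  | zero => simp
  | succ k ih =>
    rw [Finset.sum_range_succ, Finset.sum_range_succ, ih, Nat.add_sub_cancel]
    ring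

/-- After summation by parts the Fourier term is a nonnegative multiple of the square of the first
nodal value, and is dropped. -/
theorem le_sum_mul_stiffApply (hΛ : 0 < Λ) (hN : 1 ≤ N) {K a a₁ : ℝ} (hK : 0 < K) (ha : 0 < a)
    (ha₁ : 0 < a₁) (c : Fin N → ℝ) :
    Λ ^ 2 * K / mesh Λ N * ∑ j ∈ Finset.range N, (nodal c (j + 1) - nodal c j) ^ 2
      ≤ ∑ i, c i * stiffApply Λ K a a₁ N (nodal c) i := by
  have e : ∑ i, c i * stiffApply Λ K a a₁ N (nodal c) i
      = ∑ i ∈ Finset.range N, nodal c i * stiffApply Λ K a a₁ N (nodal c) i := by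
    rw [← Fin.sum_univ_eq_sum_range (fun i => nodal c i * stiffApply Λ K a a₁ N (nodal c) i)]
    simp_rw [nodal_fin]
  have e2 : ∀ i, nodal c i * stiffApply Λ K a a₁ N (nodal c) i
      = Λ ^ 2 * K / mesh Λ N * (nodal c i * (2 * nodal c i - nodal c (i - 1) - nodal c (i + 1)))
        + Λ * K * a / (2 * a₁) * nodal c 0 * (nodal c i * if i = 0 then 1 else 0) := fun i => by
    rw [stiffApply]; ring
  rw [e]
  simp_rw [e2]
  rw [Finset.sum_add_distrib, ← Finset.mul_sum, ← Finset.mul_sum, sum_mul_second_difference,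
    nodal_last]
  have e3 : ∑ i ∈ Finset.range N, nodal c i * (if i = 0 then 1 else 0) = nodal c 0 := by
    rw [Finset.sum_eq_single 0] <;> simp +contextual
    omega
  rw [e3]
  have : 0 ≤ Λ * K * a / (2 * a₁) * nodal c 0 * nodal c 0 := by
    rw [mul_assoc, ← sq]; positivity
  linarith

end Mesh

/-! ### The spring system -/

theorem isSpringSolution_iff {Λ K a a₁ : ℝ} (hΛ : 0 < Λ) {N : ℕ} (hN : 1 ≤ N) (L₀ : ℝ → ℝ)
    (x : ℕ → ℝ → ℝ) :
    IsSpringSolution Λ K a a₁ N L₀ x ↔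
      (∀ t ≥ 0, x (N + 1) t = 0) ∧
        IsLumpedSolution Λ K a a₁ N L₀ (fun t (i : Fin N) => x ((i : ℕ) + 1) t) := by
  have hm := mesh_pos hΛ hN
  -- Springs are numbered from `1` and matrix rows from `0`. The extension by zero at index `N`
  -- plays the role of the fictitious spring `N + 1`.
  have hnod : (∀ t ≥ 0, x (N + 1) t = 0) → ∀ t > 0, ∀ j ≤ N,
      nodal (fun i : Fin N => x ((i : ℕ) + 1) t) j = x (j + 1) t := by
    intro h t ht j hj
    rcases hj.lt_or_eq with hj | rfl
    · simp [nodal, hj]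
    · rw [nodal_last, h t (le_of_lt ht)]
  have hmass : ∀ s (i : Fin N), (lumpedMass Λ N *ᵥ fun i : Fin N => x ((i : ℕ) + 1) s) i
      = mesh Λ N * x ((i : ℕ) + 1) s := fun s i => by
    rw [lumpedMass, Matrix.mulVec_diagonal]
  have hode : (∀ t ≥ 0, x (N + 1) t = 0) → ∀ t > 0,
      (HasDerivAt (fun s => lumpedMass Λ N *ᵥ fun i : Fin N => x ((i : ℕ) + 1) s)
        (load Λ N L₀ t - stiffness Λ K a a₁ N *ᵥ fun i : Fin N => x ((i : ℕ) + 1) t) t ↔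
      HasDerivAt (fun s => mesh Λ N * x 1 s)
        (Λ ^ 2 * K * ((x 2 t - x 1 t) / mesh Λ N) - Λ * K * a / (2 * a₁) * x 1 t
          - Λ / 2 * deriv L₀ t) t ∧
      ∀ j, 2 ≤ j → j ≤ N → HasDerivAt (x j)
        (Λ ^ 2 * K * ((x (j - 1) t - 2 * x j t + x (j + 1) t) / mesh Λ N ^ 2)) t) := by
    intro h t ht
    have hn := hnod h t ht
    rw [hasDerivAt_pi]
    simp_rw [hmass, Pi.sub_apply, stiffness_mulVec hΛ hN]
    have hfirst : load Λ N L₀ t ⟨0, hN⟩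
        - stiffApply Λ K a a₁ N (nodal fun i : Fin N => x ((i : ℕ) + 1) t) 0
        = Λ ^ 2 * K * ((x 2 t - x 1 t) / mesh Λ N) - Λ * K * a / (2 * a₁) * x 1 t
          - Λ / 2 * deriv L₀ t := by
      rw [stiffApply, Nat.zero_sub, hn 0 (by omega), hn 1 hN]
      simp only [load, if_true]
      ring
    have hinner : ∀ k (hk : k < N), 1 ≤ k → load Λ N L₀ t ⟨k, hk⟩
        - stiffApply Λ K a a₁ N (nodal fun i : Fin N => x ((i : ℕ) + 1) t) k
        = mesh Λ N * (Λ ^ 2 * K * ((x k t - 2 * x (k + 1) t + x (k + 2) t) / mesh Λ N ^ 2)) := by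
      intro k hk hk1
      rw [stiffApply, hn k hk.le, hn (k - 1) (by omega), hn (k + 1) hk, Nat.sub_add_cancel hk1,
        if_neg (by omega)]
      simp only [load, if_neg (show ¬ k = 0 by omega)]
      field_simp
      ring
    constructor
    · intro H
      refine ⟨?_, fun j hj hjN => ?_⟩
      · have := H ⟨0, hN⟩
        rwa [hfirst] at this
      · obtain ⟨k, rfl⟩ : ∃ k, j = k + 1 := ⟨j - 1, by omega⟩
        have := (H ⟨k, hjN⟩)
        dsimp only at this
        rw [hinner k hjN (by omega)] at this
        have h2 := this.const_mul (mesh Λ N)⁻¹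
        simp_rw [inv_mul_cancel_left₀ hm.ne'] at h2
        exact h2
    · rintro ⟨H0, H⟩ ⟨k, hk⟩
      dsimp only
      rcases Nat.eq_zero_or_pos k with rfl | hk0
      · rw [hfirst]; exact H0
      · rw [hinner k hk hk0]
        exact (H (k + 1) (by omega) hk).const_mul _
  have hcont : (∀ j, 1 ≤ j → j ≤ N → ContinuousOn (x j) (Ici 0)) ↔
      ContinuousOn (fun t (i : Fin N) => x ((i : ℕ) + 1) t) (Ici 0) := by
    rw [continuousOn_pi]
    constructor
    · exact fun H i => H _ (by omega) i.2
    · intro H j hj hjN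
      have := H ⟨j - 1, by omega⟩
      simp only [Nat.sub_add_cancel hj] at this
      exact this
  constructor
  · intro H
    exact ⟨H.last, hcont.1 H.continuousOn, fun t ht =>
      (hode H.last t ht).2 ⟨H.first t ht, fun j h1 h2 => H.inner j h1 h2 t ht⟩⟩
  · rintro ⟨hl, H⟩
    exact ⟨hcont.2 H.continuousOn, fun t ht => ((hode hl t ht).1 (H.ode t ht)).1,
      fun j h1 h2 t ht => ((hode hl t ht).1 (H.ode t ht)).2 j h1 h2, hl⟩

/-! ### Estimates in `L²(0, Λ)` -/

theorem normL2_sq (Λ : ℝ) (f : ℝ → ℝ) : normL2 Λ f ^ 2 = ∫⁻ y, ‖f y‖ₑ ^ 2 ∂(dom Λ) := by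
  have := eLpNorm_nnreal_pow_eq_lintegral (f := f) (μ := dom Λ) (p := 2) (by norm_num)
  simpa [normL2] using this

theorem normL2_eq_ofReal {Λ : ℝ} {f : ℝ → ℝ} (hf : MemLp f 2 (dom Λ)) :
    normL2 Λ f = ENNReal.ofReal (Real.sqrt (∫ y, f y ^ 2 ∂(dom Λ))) := by
  have h1 : normL2 Λ f ^ 2 = ENNReal.ofReal (∫ y, f y ^ 2 ∂(dom Λ)) := by
    rw [normL2_sq, ofReal_integral_eq_lintegral_ofReal hf.integrable_sq
      (.of_forall fun y => sq_nonneg _)]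
    refine lintegral_congr fun y => ?_
    rw [Real.enorm_eq_ofReal_abs, ← ENNReal.ofReal_pow (abs_nonneg _), sq_abs]
  have h2 : ENNReal.ofReal (Real.sqrt (∫ y, f y ^ 2 ∂(dom Λ))) ^ 2
      = ENNReal.ofReal (∫ y, f y ^ 2 ∂(dom Λ)) := by
    rw [← ENNReal.ofReal_pow (Real.sqrt_nonneg _),
      Real.sq_sqrt (integral_nonneg fun y => sq_nonneg _)]
  exact (ENNReal.pow_right_strictMono two_ne_zero).injective (h1.trans h2.symm)

theorem memLp_of_continuousOn {Λ : ℝ} {f : ℝ → ℝ} (hf : ContinuousOn f (Icc 0 Λ)) :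
    MemLp f 2 (dom Λ) := by
  obtain ⟨C, hC⟩ := isCompact_Icc.exists_bound_of_continuousOn hf
  refine MemLp.of_bound ((hf.mono Ioo_subset_Icc_self).aestronglyMeasurable measurableSet_Ioo) C ?_
  rw [dom, ae_restrict_iff' measurableSet_Ioo]
  exact .of_forall fun x hx => hC x (Ioo_subset_Icc_self hx)

/-- Cauchy–Schwarz, obtained from the nonnegativity of `∫ (|g| - m)²` with `m` the mean of `|g|`. -/
theorem sq_integral_abs_le {p q : ℝ} (hpq : p ≤ q) {g : ℝ → ℝ}
    (hg : IntervalIntegrable g volume p q) (hg2 : IntervalIntegrable (fun y => g y ^ 2) volume p q) :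
    (∫ y in p..q, |g y|) ^ 2 ≤ (q - p) * ∫ y in p..q, g y ^ 2 := by
  rcases hpq.eq_or_lt with rfl | hlt
  · simp
  set B := ∫ y in p..q, |g y| with hB
  set m := B / (q - p) with hm
  have hL : 0 < q - p := sub_pos.2 hlt
  have h0 : 0 ≤ ∫ y in p..q, (|g y| - m) ^ 2 :=
    intervalIntegral.integral_nonneg hpq fun y _ => sq_nonneg _
  have h1 : ∫ y in p..q, (|g y| - m) ^ 2
      = (∫ y in p..q, g y ^ 2) - 2 * m * B + (q - p) * m ^ 2 := by
    have : ∀ y, (|g y| - m) ^ 2 = g y ^ 2 - 2 * m * |g y| + m ^ 2 := fun y => by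
      rw [← sq_abs (g y)]; ring
    simp_rw [this]
    rw [intervalIntegral.integral_add (hg2.sub (hg.abs.const_mul _)) (by simp),
      intervalIntegral.integral_sub hg2 (hg.abs.const_mul _), intervalIntegral.integral_const_mul,
      intervalIntegral.integral_const, smul_eq_mul]
  have h2 : B = m * (q - p) := by rw [hm]; field_simp
  rw [h1] at h0
  rw [h2] at h0 ⊢
  nlinarith

theorem HasPrimitive.mono {a b p q : ℝ} {F f : ℝ → ℝ} (hF : HasPrimitive a b F f)
    (hp : p ∈ Icc a b) (hq : q ∈ Icc a b) : HasPrimitive p q F f := by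
  refine ⟨hF.int_mono hp hq, fun x hx => ?_⟩
  rw [← hF.sub_eq hp ⟨hp.1.trans hx.1, hx.2.trans hq.2⟩]
  ring

theorem integral_le_const_mul {p q M : ℝ} (hpq : p ≤ q) {f : ℝ → ℝ}
    (hf : ContinuousOn f (Icc p q)) (hM : ∀ y ∈ Icc p q, f y ≤ M) :
    ∫ y in p..q, f y ≤ (q - p) * M := by
  have := intervalIntegral.integral_mono_on (μ := volume) (g := fun _ => M) hpq
    (hf.mono (by rw [uIcc_of_le hpq])).intervalIntegrable intervalIntegrable_const hM
  simpa using this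

/-! ### Norm equivalence, interpolation, quadrature and consistency on the mesh -/

section Mesh

variable {Λ : ℝ} {N : ℕ}

theorem node_succ (j : ℕ) : ((j + 1 : ℕ) : ℝ) * mesh Λ N - j * mesh Λ N = mesh Λ N := by
  push_cast; ring

theorem exists_cell_coord (hΛ : 0 < Λ) (hN : 1 ≤ N) (j : ℕ) {y : ℝ}
    (hy : y ∈ Icc ((j : ℝ) * mesh Λ N) (((j + 1 : ℕ) : ℝ) * mesh Λ N)) :
    0 ≤ (y - j * mesh Λ N) / mesh Λ N ∧ (y - j * mesh Λ N) / mesh Λ N ≤ 1 := by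
  have h := mesh_pos hΛ hN
  refine ⟨div_nonneg (by linarith [hy.1]) h.le, ?_⟩
  rw [div_le_one h]
  linarith [hy.2, node_succ (Λ := Λ) (N := N) j]

theorem sum_range_succ_sq_nodal_le (c : Fin N → ℝ) :
    ∑ j ∈ Finset.range N, nodal c (j + 1) ^ 2 ≤ ∑ j ∈ Finset.range N, nodal c j ^ 2 := by
  have h1 := Finset.sum_range_succ (fun j => nodal c j ^ 2) N
  have h2 := Finset.sum_range_succ' (fun j => nodal c j ^ 2) N
  simp only [nodal_last] at h1
  nlinarith [sq_nonneg (nodal c 0)]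

theorem sum_range_nodal_sq (c : Fin N → ℝ) :
    ∑ j ∈ Finset.range N, nodal c j ^ 2 = ∑ i, c i ^ 2 := by
  rw [← Fin.sum_univ_eq_sum_range (fun j => nodal c j ^ 2)]
  simp_rw [nodal_fin]

/-- On a cell the function is a convex combination of its two end values, so its square is at most
the sum of their squares. Each node belongs to at most two cells, whence the factor `2`. -/
theorem integral_p1_sq_le (hΛ : 0 < Λ) (hN : 1 ≤ N) (c : Fin N → ℝ) :
    ∫ y, p1 Λ N c y ^ 2 ∂(dom Λ) ≤ 2 * (mesh Λ N * ∑ i, c i ^ 2) := by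
  have h := mesh_pos hΛ hN
  have hc : Continuous fun y => p1 Λ N c y ^ 2 := (continuous_p1 Λ N c).pow 2
  rw [integral_dom hΛ.le, integral_eq_sum_cells hΛ hN (hc.intervalIntegrable _ _)]
  have hcell : ∀ j ∈ Finset.range N,
      ∫ y in (j : ℝ) * mesh Λ N..((j + 1 : ℕ) : ℝ) * mesh Λ N, p1 Λ N c y ^ 2
        ≤ mesh Λ N * (nodal c j ^ 2 + nodal c (j + 1) ^ 2) := by
    intro j _
    refine (integral_le_const_mul (node_le hΛ hN j) hc.continuousOn
      (M := nodal c j ^ 2 + nodal c (j + 1) ^ 2) fun y hy => ?_).trans_eq (by rw [node_succ])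
    obtain ⟨h0, h1⟩ := exists_cell_coord hΛ hN j hy
    rw [p1_cell hΛ hN c j hy]
    set τ := (y - j * mesh Λ N) / mesh Λ N
    nlinarith [mul_nonneg (mul_nonneg h0 (sub_nonneg.2 h1)) (sq_nonneg (nodal c (j+1) - nodal c j)),
      mul_nonneg h0 (sq_nonneg (nodal c j)),
      mul_nonneg (sub_nonneg.2 h1) (sq_nonneg (nodal c (j + 1)))]
  refine (Finset.sum_le_sum hcell).trans ?_
  rw [← Finset.mul_sum, Finset.sum_add_distrib, ← sum_range_nodal_sq c]
  nlinarith [sum_range_succ_sq_nodal_le c]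

theorem le_integral_p1_sq (hΛ : 0 < Λ) (hN : 1 ≤ N) (c : Fin N → ℝ) :
    mesh Λ N * ∑ i, c i ^ 2 ≤ 4 * ∫ y, p1 Λ N c y ^ 2 ∂(dom Λ) := by
  have h := mesh_pos hΛ hN
  have hc : Continuous fun y => p1 Λ N c y ^ 2 := (continuous_p1 Λ N c).pow 2
  rw [integral_dom hΛ.le, integral_eq_sum_cells hΛ hN (hc.intervalIntegrable _ _),
    ← sum_range_nodal_sq c, Finset.mul_sum, Finset.mul_sum]
  refine Finset.sum_le_sum fun j _ => ?_
  set p := (j : ℝ) * mesh Λ N with hp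
  set d := nodal c (j + 1) - nodal c j with hd
  have e : ∫ y in p..((j + 1 : ℕ) : ℝ) * mesh Λ N, p1 Λ N c y ^ 2
      = ∫ y in p..((j + 1 : ℕ) : ℝ) * mesh Λ N, (nodal c j + (y - p) / mesh Λ N * d) ^ 2 := by
    refine intervalIntegral.integral_congr fun y hy => ?_
    rw [uIcc_of_le (node_le hΛ hN j)] at hy
    simp only [p1_cell hΛ hN c j hy]
    rfl
  have hder : ∀ y ∈ uIcc p (((j + 1 : ℕ) : ℝ) * mesh Λ N),
      HasDerivAt (fun y => nodal c j ^ 2 * (y - p) + nodal c j * d / mesh Λ N * (y - p) ^ 2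
        + d ^ 2 / (3 * mesh Λ N ^ 2) * (y - p) ^ 3)
        ((nodal c j + (y - p) / mesh Λ N * d) ^ 2) y := by
    intro y _
    have h1 : HasDerivAt (fun y => y - p) 1 y := (hasDerivAt_id y).sub_const p
    refine ((h1.const_mul (nodal c j ^ 2)).add ((h1.pow 2).const_mul _) |>.add
      ((h1.pow 3).const_mul _)).congr_deriv ?_
    field_simp
    push_cast
    ring
  rw [e, intervalIntegral.integral_eq_sub_of_hasDerivAt hder
    (Continuous.intervalIntegrable (by fun_prop) _ _), node_succ]
  -- Completing the square: `4 (n² + n d + d²/3) = n² + (3n + 2d)²/3`. The constant `4` allows each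
  -- cell to pay for its left node alone.
  have : 4 * (nodal c j ^ 2 * mesh Λ N + nodal c j * d / mesh Λ N * mesh Λ N ^ 2
      + d ^ 2 / (3 * mesh Λ N ^ 2) * mesh Λ N ^ 3
      - (nodal c j ^ 2 * (p - p) + nodal c j * d / mesh Λ N * (p - p) ^ 2
      + d ^ 2 / (3 * mesh Λ N ^ 2) * (p - p) ^ 3))
      = mesh Λ N * (nodal c j ^ 2) + mesh Λ N * (1 / 3) * (3 * nodal c j + 2 * d) ^ 2 := by
    field_simp; ring
  rw [this]
  have : 0 ≤ mesh Λ N * (1 / 3) * (3 * nodal c j + 2 * d) ^ 2 := by positivity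
  linarith

/-- The nodal interpolation error of a function with two weak derivatives. -/
theorem integral_sub_p1_sq_le (hΛ : 0 < Λ) (hN : 1 ≤ N) {u v g : ℝ → ℝ}
    (hu : HasPrimitive 0 Λ u v) (hv : HasPrimitive 0 Λ v g) (hg : MemLp g 2 (dom Λ))
    (h0 : u Λ = 0) :
    ∫ y, (p1 Λ N (fun i => u (i * mesh Λ N)) y - u y) ^ 2 ∂(dom Λ)
      ≤ mesh Λ N ^ 4 * ∫ y, g y ^ 2 ∂(dom Λ) := by
  have h := mesh_pos hΛ hN
  have huc := hu.continuousOn hΛ.le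
  have hvc := hv.continuousOn hΛ.le
  set c : Fin N → ℝ := fun i => u (i * mesh Λ N) with hc
  have hn : ∀ j ≤ N, nodal c j = u (j * mesh Λ N) := by
    intro j hj
    rcases hj.lt_or_eq with hj | rfl
    · simp [nodal, hj, hc]
    · rw [nodal_last, natCast_mul_mesh hN, h0]
  have hec : ContinuousOn (fun y => (p1 Λ N c y - u y) ^ 2) (Icc 0 Λ) :=
    ((continuous_p1 Λ N c).continuousOn.sub huc).pow 2
  have hg2 : IntervalIntegrable (fun y => g y ^ 2) volume 0 Λ :=
    (integrable_dom_iff hΛ.le).1 hg.integrable_sq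
  rw [integral_dom hΛ.le, integral_dom hΛ.le, integral_eq_sum_cells hΛ hN hg2,
    integral_eq_sum_cells hΛ hN (hec.mono (by rw [uIcc_of_le hΛ.le])).intervalIntegrable,
    Finset.mul_sum]
  refine Finset.sum_le_sum fun j hj => ?_
  have hj := Finset.mem_range.1 hj
  have hp := node_mem hΛ hN hj.le
  have hq := node_mem hΛ hN hj
  have hpq := node_le hΛ hN (Λ := Λ) j
  have hs := node_succ (Λ := Λ) (N := N) j
  have hsub := cell_subset hΛ hN hj
  have hcoord := fun y => exists_cell_coord hΛ hN j (y := y)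
  have hp1 := fun y => p1_cell hΛ hN c j (y := y)
  rw [hn j hj.le, hn (j + 1) hj] at hp1
  set p := (j : ℝ) * mesh Λ N with hpdef
  set q := ((j + 1 : ℕ) : ℝ) * mesh Λ N with hqdef
  have hu' := hu.mono hp hq
  have hv' := hv.mono hp hq
  set B := ∫ z in p..q, |g z| with hB
  have hB0 : 0 ≤ B := intervalIntegral.integral_nonneg hpq fun _ _ => abs_nonneg _
  have hCS : B ^ 2 ≤ mesh Λ N * ∫ y in p..q, g y ^ 2 := by
    rw [← hs]
    refine sq_integral_abs_le hpq hv'.int (hg2.mono_set ?_)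
    rw [uIcc_of_le hpq, uIcc_of_le hΛ.le]; exact hsub
  have hpm : p ∈ Icc p q := ⟨le_rfl, hpq⟩
  have hqm : q ∈ Icc p q := ⟨hpq, le_rfl⟩
  -- The derivative `v` varies by at most `B` on the cell, so every increment of `u` is compared
  -- with the same slope `v p`.
  have hlin : ∀ x ∈ Icc p q, ∀ y ∈ Icc p q, x ≤ y →
      |u y - u x - (y - x) * v p| ≤ (y - x) * B := by
    intro x hx y hy hxy
    have e : u y - u x - (y - x) * v p = ∫ z in x..y, (v z - v p) := by
      rw [intervalIntegral.integral_sub (hu'.int_mono hx hy) (by simp), hu'.sub_eq hx hy,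
        intervalIntegral.integral_const, smul_eq_mul]
    rw [e]
    have := intervalIntegral.norm_integral_le_of_norm_le_const (a := x) (b := y)
      (f := fun z => v z - v p) (C := B) (fun z hz => by
        rw [uIoc_of_le hxy] at hz
        exact hv'.abs_sub_le hpq hpm ⟨hx.1.trans hz.1.le, hz.2.trans hy.2⟩)
    rw [abs_of_nonneg (sub_nonneg.2 hxy)] at this
    rw [mul_comm]
    exact this
  have hpt : ∀ y ∈ Icc p q, (p1 Λ N c y - u y) ^ 2 ≤ (mesh Λ N * B) ^ 2 := by
    intro y hy
    rw [sq_le_sq, abs_of_nonneg (mul_nonneg h.le hB0)]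
    obtain ⟨h0, h1⟩ := hcoord y hy
    have e1 := hlin p hpm y hy hy.1
    have e2 := hlin y hy q hqm hy.2
    rw [hp1 y hy]
    set τ := (y - p) / mesh Λ N with hτ
    have hy1 : y - p = τ * mesh Λ N := by rw [hτ]; field_simp
    have hy2 : q - y = (1 - τ) * mesh Λ N := by linarith
    rw [hy1, abs_le] at e1
    rw [hy2, abs_le] at e2
    -- The interpolation error is `τ (u q - u y) - (1 - τ) (u y - u p)`. With these weights the two
    -- terms in `v p` cancel, and `2 τ (1 - τ) h B ≤ h B` remains.
    have k1 := mul_le_mul_of_nonneg_left e1.1 (sub_nonneg.2 h1)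
    have k2 := mul_le_mul_of_nonneg_left e1.2 (sub_nonneg.2 h1)
    have k3 := mul_le_mul_of_nonneg_left e2.1 h0
    have k4 := mul_le_mul_of_nonneg_left e2.2 h0
    have k5 : 2 * (τ * (1 - τ)) * (mesh Λ N * B) ≤ 1 * (mesh Λ N * B) := by
      refine mul_le_mul_of_nonneg_right ?_ (by positivity)
      nlinarith [sq_nonneg (2 * τ - 1)]
    rw [abs_le]
    constructor <;> nlinarith
  have hI := integral_le_const_mul hpq (hec.mono hsub) hpt
  rw [hs] at hI
  refine hI.trans ?_
  calc mesh Λ N * (mesh Λ N * B) ^ 2 = mesh Λ N ^ 3 * B ^ 2 := by ring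
    _ ≤ mesh Λ N ^ 3 * (mesh Λ N * ∫ y in p..q, g y ^ 2) := by gcongr
    _ = _ := by ring

theorem abs_nodal_le (c : Fin N → ℝ) {j : ℕ} (hj : j ≤ N) :
    |nodal c j| ≤ ∑ k ∈ Finset.range N, |nodal c (k + 1) - nodal c k| := by
  have h := dist_le_Ico_sum_dist (nodal c) hj
  rw [Real.dist_eq, nodal_last, sub_zero] at h
  refine h.trans ?_
  simp_rw [Real.dist_eq, abs_sub_comm (nodal c (_ + 1))]
  refine Finset.sum_le_sum_of_subset_of_nonneg ?_ fun _ _ _ => abs_nonneg _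
  intro k hk
  exact Finset.mem_range.2 (Finset.mem_Ico.1 hk).2

/-- The quadrature error of the left rectangle rule on the products `m θ_h`, `θ_h ∈ 𝒱_h`. -/
theorem abs_integral_mul_p1_sub_le (hΛ : 0 < Λ) (hN : 1 ≤ N) {m w : ℝ → ℝ}
    (hm : HasPrimitive 0 Λ m w) (h0 : m Λ = 0) (θ : Fin N → ℝ) :
    |∫ y, m y * p1 Λ N θ y ∂(dom Λ) - mesh Λ N * ∑ i : Fin N, m (i * mesh Λ N) * θ i|
      ≤ 2 * mesh Λ N * (∫ y in (0 : ℝ)..Λ, |w y|)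
        * ∑ j ∈ Finset.range N, |nodal θ (j + 1) - nodal θ j| := by
  have h := mesh_pos hΛ hN
  set S := ∑ j ∈ Finset.range N, |nodal θ (j + 1) - nodal θ j| with hS
  have hS0 : 0 ≤ S := Finset.sum_nonneg fun _ _ => abs_nonneg _
  set M := ∫ y in (0 : ℝ)..Λ, |w y| with hM
  have hmc := hm.continuousOn hΛ.le
  have hpc := continuous_p1 Λ N θ
  have hint : ContinuousOn (fun y => m y * p1 Λ N θ y) (Icc 0 Λ) := hmc.mul hpc.continuousOn
  have hsum : ∑ i : Fin N, m (i * mesh Λ N) * θ i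
      = ∑ j ∈ Finset.range N, m (j * mesh Λ N) * nodal θ j := by
    rw [← Fin.sum_univ_eq_sum_range (fun j => m (j * mesh Λ N) * nodal θ j)]
    simp_rw [nodal_fin]
  have hMsum : M = ∑ j ∈ Finset.range N,
      ∫ y in (j : ℝ) * mesh Λ N..((j + 1 : ℕ) : ℝ) * mesh Λ N, |w y| :=
    integral_eq_sum_cells hΛ hN hm.int.abs
  rw [integral_dom hΛ.le, integral_eq_sum_cells hΛ hN
    (hint.mono (by rw [uIcc_of_le hΛ.le])).intervalIntegrable, hsum, Finset.mul_sum,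
    ← Finset.sum_sub_distrib]
  refine (Finset.abs_sum_le_sum_abs _ _).trans ?_
  -- On a cell, `m θ_h - m(p) θ_j = (m - m(p)) θ_h + m(p) (θ_h - θ_j)`. Since `m` and `θ_h` vanish
  -- at `Λ`, they are bounded by their total variations, at most `M` and `S`; summed over the cells,
  -- each of the two terms gives `h M S`.
  have hcell : ∀ j ∈ Finset.range N,
      |(∫ y in (j : ℝ) * mesh Λ N..((j + 1 : ℕ) : ℝ) * mesh Λ N, m y * p1 Λ N θ y)
        - mesh Λ N * (m (j * mesh Λ N) * nodal θ j)|
      ≤ mesh Λ N * ((∫ y in (j : ℝ) * mesh Λ N..((j + 1 : ℕ) : ℝ) * mesh Λ N, |w y|) * S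
        + M * |nodal θ (j + 1) - nodal θ j|) := by
    intro j hj
    have hj := Finset.mem_range.1 hj
    have hp := node_mem hΛ hN hj.le
    have hq := node_mem hΛ hN hj
    have hpq := node_le hΛ hN (Λ := Λ) j
    have hs := node_succ (Λ := Λ) (N := N) j
    have hsub := cell_subset hΛ hN hj
    have hcoord := fun y => exists_cell_coord hΛ hN j (y := y)
    have hp1 := fun y => p1_cell hΛ hN θ j (y := y)
    have hm' := hm.mono hp hq
    have hmp : |m (j * mesh Λ N)| ≤ M := by
      have := hm.abs_sub_le hΛ.le (x := Λ) ⟨hΛ.le, le_rfl⟩ hp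
      rwa [h0, sub_zero] at this
    set p := (j : ℝ) * mesh Λ N with hpdef
    set q := ((j + 1 : ℕ) : ℝ) * mesh Λ N with hqdef
    set A := ∫ y in p..q, |w y|
    have hpm : p ∈ Icc p q := ⟨le_rfl, hpq⟩
    have e : (∫ y in p..q, m y * p1 Λ N θ y) - mesh Λ N * (m p * nodal θ j)
        = ∫ y in p..q, (m y * p1 Λ N θ y - m p * nodal θ j) := by
      rw [intervalIntegral.integral_sub _ (by simp), intervalIntegral.integral_const, hs,
        smul_eq_mul]
      exact (hint.mono (by rw [uIcc_of_le hpq]; exact hsub)).intervalIntegrable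
    rw [e]
    have := intervalIntegral.norm_integral_le_of_norm_le_const (a := p) (b := q)
      (f := fun y => m y * p1 Λ N θ y - m p * nodal θ j)
      (C := A * S + M * |nodal θ (j + 1) - nodal θ j|) (fun y hy => by
        rw [uIoc_of_le hpq] at hy
        have hy : y ∈ Icc p q := ⟨hy.1.le, hy.2⟩
        obtain ⟨t0, t1⟩ := hcoord y hy
        have a1 := hm'.abs_sub_le hpq hpm hy
        rw [hp1 y hy, Real.norm_eq_abs]
        set τ := (y - p) / mesh Λ N with hτ
        have a2 : |nodal θ j + τ * (nodal θ (j + 1) - nodal θ j)| ≤ S := by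
          have b1 := abs_le.1 (abs_nodal_le θ hj.le)
          have b2 := abs_le.1 (abs_nodal_le θ hj)
          rw [← hS] at b1 b2
          rw [abs_le]
          have k1 := mul_le_mul_of_nonneg_left b1.1 (sub_nonneg.2 t1)
          have k2 := mul_le_mul_of_nonneg_left b1.2 (sub_nonneg.2 t1)
          have k3 := mul_le_mul_of_nonneg_left b2.1 t0
          have k4 := mul_le_mul_of_nonneg_left b2.2 t0
          constructor <;> linarith
        have a3 : |τ * (nodal θ (j + 1) - nodal θ j)| ≤ |nodal θ (j + 1) - nodal θ j| := by
          rw [abs_mul, abs_of_nonneg t0]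
          exact mul_le_of_le_one_left (abs_nonneg _) t1
        calc |m y * (nodal θ j + τ * (nodal θ (j + 1) - nodal θ j)) - m p * nodal θ j|
            = |(m y - m p) * (nodal θ j + τ * (nodal θ (j + 1) - nodal θ j))
              + m p * (τ * (nodal θ (j + 1) - nodal θ j))| := by congr 1; ring
          _ ≤ _ := by
            refine (abs_add_le _ _).trans ?_
            rw [abs_mul, abs_mul (m p)]
            exact add_le_add (mul_le_mul a1 a2 (abs_nonneg _) ((abs_nonneg _).trans a1))
              (mul_le_mul hmp a3 (abs_nonneg _) ((abs_nonneg _).trans hmp)))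
    rw [hs, abs_of_pos h] at this
    rw [mul_comm (mesh Λ N)]
    exact this
  refine (Finset.sum_le_sum hcell).trans_eq ?_
  rw [← Finset.mul_sum, Finset.sum_add_distrib, ← Finset.sum_mul, ← Finset.mul_sum, ← hMsum, ← hS]
  ring

/-- The dissipation of the discrete problem dominates the consistency error. -/
theorem consistency_sub_dissipation_le (hΛ : 0 < Λ) (hN : 1 ≤ N) {K a a₁ : ℝ} (hK : 0 < K)
    (ha : 0 < a) (ha₁ : 0 < a₁) {m w : ℝ → ℝ} (hm : HasPrimitive 0 Λ m w) (h0 : m Λ = 0)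
    (hw : MemLp w 2 (dom Λ)) (θ : Fin N → ℝ) :
    ∑ i : Fin N, θ i * (∫ y, m y * hat Λ N i y ∂(dom Λ) - mesh Λ N * m (i * mesh Λ N)
        - stiffApply Λ K a a₁ N (nodal θ) i)
      ≤ mesh Λ N ^ 2 / K * ∫ y, w y ^ 2 ∂(dom Λ) := by
  have h := mesh_pos hΛ hN
  have hq := abs_integral_mul_p1_sub_le hΛ hN hm h0 θ
  have hd := le_sum_mul_stiffApply hΛ hN hK ha ha₁ θ
  set S := ∑ j ∈ Finset.range N, |nodal θ (j + 1) - nodal θ j| with hS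
  set D := ∑ j ∈ Finset.range N, (nodal θ (j + 1) - nodal θ j) ^ 2 with hD
  set M := ∫ y in (0 : ℝ)..Λ, |w y| with hM
  have hSD : S ^ 2 ≤ N * D := by
    have := sq_sum_le_card_mul_sum_sq (s := Finset.range N)
      (f := fun j => |nodal θ (j + 1) - nodal θ j|)
    simpa only [sq_abs, Finset.card_range] using this
  have hM2 : M ^ 2 ≤ Λ * ∫ y, w y ^ 2 ∂(dom Λ) := by
    have := sq_integral_abs_le hΛ.le hm.int ((integrable_dom_iff hΛ.le).1 hw.integrable_sq)
    rwa [sub_zero, ← integral_dom hΛ.le (fun y => w y ^ 2)] at this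
  have hmc := hm.continuousOn hΛ.le
  have hp1 : ∫ y, m y * p1 Λ N θ y ∂(dom Λ) = ∑ i, θ i * ∫ y, m y * hat Λ N i y ∂(dom Λ) := by
    simp_rw [← integral_const_mul]
    rw [← integral_finsetSum]
    · congr 1; ext y
      rw [p1, Finset.mul_sum]
      exact Finset.sum_congr rfl fun i _ => by ring
    · intro i _
      refine Integrable.const_mul ?_ _
      rw [integrable_dom_iff hΛ.le]
      refine ContinuousOn.intervalIntegrable ?_
      rw [uIcc_of_le hΛ.le]
      exact hmc.mul (continuous_hat Λ N i).continuousOn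
  have hsplit : ∑ i : Fin N, θ i * (∫ y, m y * hat Λ N i y ∂(dom Λ) - mesh Λ N * m (i * mesh Λ N)
        - stiffApply Λ K a a₁ N (nodal θ) i)
      = (∫ y, m y * p1 Λ N θ y ∂(dom Λ) - mesh Λ N * ∑ i : Fin N, m (i * mesh Λ N) * θ i)
        - ∑ i, θ i * stiffApply Λ K a a₁ N (nodal θ) i := by
    rw [hp1, Finset.mul_sum, ← Finset.sum_sub_distrib, ← Finset.sum_sub_distrib]
    exact Finset.sum_congr rfl fun i _ => by ring
  rw [hsplit]
  have hΛN : Λ = N * mesh Λ N := (natCast_mul_mesh hN).symm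
  -- The weight `Λ K` is what the dissipation can pay: `S² ≤ N D` and `Λ K N = Λ² K / h`.
  have hyoung : 2 * mesh Λ N * M * S ≤ Λ * K * S ^ 2 + mesh Λ N ^ 2 / (Λ * K) * M ^ 2 := by
    have : Λ * K * S ^ 2 + mesh Λ N ^ 2 / (Λ * K) * M ^ 2 - 2 * mesh Λ N * M * S
        = (Λ * K * S - mesh Λ N * M) ^ 2 / (Λ * K) := by field_simp; ring
    have h2 : 0 ≤ (Λ * K * S - mesh Λ N * M) ^ 2 / (Λ * K) := by positivity
    linarith
  have h1 : Λ * K * S ^ 2 ≤ Λ ^ 2 * K / mesh Λ N * D := by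
    calc Λ * K * S ^ 2 ≤ Λ * K * (N * D) := by gcongr
      _ = Λ ^ 2 * K / mesh Λ N * D := by
        have : (N : ℝ) = Λ / mesh Λ N := by rw [eq_div_iff h.ne']; exact hΛN.symm
        rw [this]; ring
  have h2 : mesh Λ N ^ 2 / (Λ * K) * M ^ 2 ≤ mesh Λ N ^ 2 / K * ∫ y, w y ^ 2 ∂(dom Λ) := by
    calc mesh Λ N ^ 2 / (Λ * K) * M ^ 2
        ≤ mesh Λ N ^ 2 / (Λ * K) * (Λ * ∫ y, w y ^ 2 ∂(dom Λ)) := by gcongr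
      _ = _ := by field_simp
  linarith [(abs_le.1 hq).2]

end Mesh

/-! ### Time dependent functions with an integrable mixed derivative -/

theorem dom_prod (t Λ : ℝ) :
    (dom t).prod (dom Λ) = (volume : Measure (ℝ × ℝ)).restrict (Ioo 0 t ×ˢ Ioo 0 Λ) := by
  rw [dom, dom, Measure.prod_restrict, Measure.volume_eq_prod]

theorem integrable_prod_mono {t s Λ : ℝ} (hst : s ≤ t) {f : ℝ × ℝ → ℝ}
    (hf : Integrable f ((dom t).prod (dom Λ))) : Integrable f ((dom s).prod (dom Λ)) := by
  rw [dom_prod] at hf ⊢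
  exact IntegrableOn.mono_set hf (prod_mono_left (Ioo_subset_Ioo_right hst))

theorem integrable_prod_mul {t Λ : ℝ} {w : ℝ → ℝ → ℝ}
    (hw : Integrable (Function.uncurry w) ((dom t).prod (dom Λ))) {H : ℝ → ℝ} {C : ℝ}
    (hH : AEStronglyMeasurable H (dom Λ)) (hC : ∀ᵐ y ∂(dom Λ), ‖H y‖ ≤ C) :
    Integrable (fun p : ℝ × ℝ => w p.1 p.2 * H p.2) ((dom t).prod (dom Λ)) :=
  Integrable.mul_bdd hw hH.comp_snd (Measure.quasiMeasurePreserving_snd.ae hC)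

/-- The primitive of `f` that vanishes at `Λ`. -/
noncomputable def tail (Λ : ℝ) (f : ℝ → ℝ) (y : ℝ) : ℝ := -∫ z in y..Λ, f z

theorem tail_self (Λ : ℝ) (f : ℝ → ℝ) : tail Λ f Λ = 0 := by simp [tail]

theorem hasPrimitive_tail {Λ : ℝ} (hΛ : 0 < Λ) {f : ℝ → ℝ} (hf : Integrable f (dom Λ)) :
    HasPrimitive 0 Λ (tail Λ f) f := by
  have hi := (integrable_dom_iff hΛ.le).1 hf
  refine ⟨hi, fun x hx => ?_⟩
  have hm : ∀ a b : ℝ, a ∈ Icc 0 Λ → b ∈ Icc 0 Λ → IntervalIntegrable f volume a b :=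
    fun a b ha hb => hi.mono_set (by rw [uIcc_of_le hΛ.le]; exact uIcc_subset_Icc ha hb)
  have h0 : (0 : ℝ) ∈ Icc 0 Λ := ⟨le_rfl, hΛ.le⟩
  have := intervalIntegral.integral_add_adjacent_intervals (hm 0 x h0 hx)
    (hm x Λ hx ⟨hΛ.le, le_rfl⟩)
  rw [tail, tail, ← this]; ring

/-- Both boundary terms vanish, since the tail is zero at `Λ` and `G` is zero at `0`; thus `G` need
not vanish at `Λ`. -/
theorem integral_tail_mul {Λ : ℝ} (hΛ : 0 < Λ) {f G g : ℝ → ℝ} (hf : Integrable f (dom Λ))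
    (hG : HasPrimitive 0 Λ G g) (h0 : G 0 = 0) :
    ∫ y, tail Λ f y * g y ∂(dom Λ) = -∫ y, f y * G y ∂(dom Λ) := by
  rw [integral_dom hΛ.le, integral_dom hΛ.le, (hasPrimitive_tail hΛ hf).integral_mul hΛ.le hG,
    tail_self, h0]
  ring

theorem integrable_integral_time {t s Λ : ℝ} (hs : s ∈ Icc 0 t) {w : ℝ → ℝ → ℝ}
    (hw : Integrable (Function.uncurry w) ((dom t).prod (dom Λ))) :
    Integrable (fun y => ∫ r in (0 : ℝ)..s, w r y) (dom Λ) := by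
  have := (integrable_prod_mono hs.2 hw).integral_prod_right
  refine this.congr (.of_forall fun y => ?_)
  exact integral_dom hs.1 fun r => w r y

theorem integral_integral_time_mul {t s Λ : ℝ} (hs : s ∈ Icc 0 t) {w : ℝ → ℝ → ℝ}
    (hw : Integrable (Function.uncurry w) ((dom t).prod (dom Λ))) {H : ℝ → ℝ} {C : ℝ}
    (hH : AEStronglyMeasurable H (dom Λ)) (hC : ∀ᵐ y ∂(dom Λ), ‖H y‖ ≤ C) :
    ∫ y, (∫ r in (0 : ℝ)..s, w r y) * H y ∂(dom Λ)
      = ∫ r in (0 : ℝ)..s, ∫ y, w r y * H y ∂(dom Λ) := by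
  rw [← integral_dom hs.1,
    integral_integral_swap (integrable_prod_mul (integrable_prod_mono hs.2 hw) hH hC)]
  congr 1; ext y
  rw [← integral_dom hs.1, ← integral_mul_const]

theorem HasPrimitive.aestronglyMeasurable {Λ : ℝ} (hΛ : 0 < Λ) {G g : ℝ → ℝ}
    (hG : HasPrimitive 0 Λ G g) : AEStronglyMeasurable G (dom Λ) :=
  (hG.integrable_dom hΛ).aestronglyMeasurable

theorem HasPrimitive.exists_bound {Λ : ℝ} (hΛ : 0 < Λ) {G g : ℝ → ℝ}
    (hG : HasPrimitive 0 Λ G g) : ∃ C, ∀ᵐ y ∂(dom Λ), ‖G y‖ ≤ C := by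
  obtain ⟨C, hC⟩ := isCompact_Icc.exists_bound_of_continuousOn (hG.continuousOn hΛ.le)
  refine ⟨C, ?_⟩
  rw [dom, ae_restrict_iff' measurableSet_Ioo]
  exact .of_forall fun x hx => hC x (Ioo_subset_Icc_self hx)

/-- The increment `ℓ(s) - ℓ(0)` in terms of the mixed derivative `w` of `ℓ`. -/
noncomputable def increment (Λ : ℝ) (w : ℝ → ℝ → ℝ) (s : ℝ) : ℝ → ℝ :=
  tail Λ fun y => ∫ r in (0 : ℝ)..s, w r y

section Increment

variable {t Λ : ℝ} {w : ℝ → ℝ → ℝ}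

theorem hasPrimitive_increment (hΛ : 0 < Λ) {s : ℝ} (hs : s ∈ Icc 0 t)
    (hw : Integrable (Function.uncurry w) ((dom t).prod (dom Λ))) :
    HasPrimitive 0 Λ (increment Λ w s) (fun y => ∫ r in (0 : ℝ)..s, w r y) :=
  hasPrimitive_tail hΛ (integrable_integral_time hs hw)

theorem integral_increment_mul (hΛ : 0 < Λ) {s : ℝ} (hs : s ∈ Icc 0 t)
    (hw : Integrable (Function.uncurry w) ((dom t).prod (dom Λ))) {G g : ℝ → ℝ}
    (hG : HasPrimitive 0 Λ G g) (h0 : G 0 = 0) :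
    ∫ y, increment Λ w s y * g y ∂(dom Λ)
      = ∫ r in (0 : ℝ)..s, -∫ y, w r y * G y ∂(dom Λ) := by
  obtain ⟨C, hC⟩ := hG.exists_bound hΛ
  rw [increment, integral_tail_mul hΛ (integrable_integral_time hs hw) hG h0,
    integral_integral_time_mul hs hw (hG.aestronglyMeasurable hΛ) hC,
    intervalIntegral.integral_neg]

theorem intervalIntegrable_integral_mul (ht : 0 < t) (hΛ : 0 < Λ)
    (hw : Integrable (Function.uncurry w) ((dom t).prod (dom Λ))) {G g : ℝ → ℝ}
    (hG : HasPrimitive 0 Λ G g) :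
    IntervalIntegrable (fun r => -∫ y, w r y * G y ∂(dom Λ)) volume 0 t := by
  obtain ⟨C, hC⟩ := hG.exists_bound hΛ
  rw [← integrable_dom_iff ht.le]
  exact (integrable_prod_mul hw (hG.aestronglyMeasurable hΛ) hC).integral_prod_left.neg

theorem tail_eq_integral_mul_indicator (f : ℝ → ℝ) {y : ℝ} (hy : y ∈ Icc 0 Λ) :
    tail Λ f y = -∫ z, f z * (Ioo y Λ).indicator 1 z ∂(dom Λ) := by
  have : ∀ z, f z * (Ioo y Λ).indicator 1 z = (Ioo y Λ).indicator f z := fun z => by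
    by_cases hz : z ∈ Ioo y Λ <;> simp [hz]
  simp_rw [this]
  rw [tail, intervalIntegral.integral_of_le hy.2, integral_Ioc_eq_integral_Ioo,
    integral_indicator measurableSet_Ioo, dom, Measure.restrict_restrict measurableSet_Ioo,
    inter_eq_left.2 (Ioo_subset_Ioo_left hy.1)]

/-- Fubini, with the tail written as an integral against an indicator. It holds at every point `y`,
not just almost every one, so nodal values can be differentiated in time, with derivative `∂_t ℓ =
tail Λ (w r)`. -/
theorem hasPrimitive_increment_time (ht : 0 < t)
    (hw : Integrable (Function.uncurry w) ((dom t).prod (dom Λ))) {y : ℝ} (hy : y ∈ Icc 0 Λ) :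
    HasPrimitive 0 t (fun s => increment Λ w s y) (fun r => tail Λ (w r) y) := by
  have hH : AEStronglyMeasurable ((Ioo y Λ).indicator (1 : ℝ → ℝ)) (dom Λ) :=
    (stronglyMeasurable_one.indicator measurableSet_Ioo).aestronglyMeasurable
  have hC : ∀ᵐ z ∂(dom Λ), ‖(Ioo y Λ).indicator (1 : ℝ → ℝ) z‖ ≤ 1 := .of_forall fun z => by
    by_cases hz : z ∈ Ioo y Λ <;> simp [hz]
  constructor
  · rw [← integrable_dom_iff ht.le]
    simp_rw [fun r => tail_eq_integral_mul_indicator (w r) hy]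
    exact (integrable_prod_mul hw hH hC).integral_prod_left.neg
  · intro s hs
    have h0 : increment Λ w 0 y = 0 := by simp [increment, tail]
    rw [h0, zero_add, increment, tail_eq_integral_mul_indicator _ hy,
      integral_integral_time_mul hs hw hH hC, ← intervalIntegral.integral_neg]
    simp_rw [fun r => tail_eq_integral_mul_indicator (w r) hy]

end Increment

/-- Separation of variables in the definition of the mixed weak derivative. -/
theorem HasMixedWeakDeriv.integral_separated {t Λ : ℝ} {ℓ w : ℝ → ℝ → ℝ}
    (h : HasMixedWeakDeriv Λ t ℓ w)
    {α β : ℝ → ℝ} (hα : IsTest t α) (hβ : IsTest Λ β) :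
    ∫ s, (∫ y, ℓ s y * deriv β y ∂(dom Λ)) * deriv α s ∂(dom t)
      = ∫ s, (∫ y, w s y * β y ∂(dom Λ)) * α s ∂(dom t) := by
  have hsupp : ∀ a b : ℝ → ℝ, IsTest t a → IsTest Λ b →
      Function.support (fun p : ℝ × ℝ => a p.1 * b p.2) ⊆ tsupport a ×ˢ tsupport b := by
    intro a b _ _ p hp
    exact ⟨subset_tsupport a (left_ne_zero_of_mul hp), subset_tsupport b (right_ne_zero_of_mul hp)⟩
  have hint : ∀ (f : ℝ → ℝ → ℝ) (a b : ℝ → ℝ), IsTest t a → IsTest Λ b →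
      LocallyIntegrableOn (Function.uncurry f) (Ioo 0 t ×ˢ Ioo 0 Λ) volume →
      Integrable (fun p : ℝ × ℝ => f p.1 p.2 * (a p.1 * b p.2)) ((dom t).prod (dom Λ)) := by
    intro f a b ha hb hf
    have hK : IsCompact (tsupport a ×ˢ tsupport b) := ha.compact.prod hb.compact
    have h1 := hf.integrableOn_compact_subset (prod_mono ha.supp hb.supp) hK
    have hc : Continuous fun p : ℝ × ℝ => a p.1 * b p.2 :=
      (ha.smooth.continuous.comp continuous_fst).mul (hb.smooth.continuous.comp continuous_snd)
    have h2 : IntegrableOn (fun p : ℝ × ℝ => f p.1 p.2 * (a p.1 * b p.2))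
        (tsupport a ×ˢ tsupport b) volume := h1.mul_continuousOn hc.continuousOn hK
    have h3 := (integrableOn_iff_integrable_of_support_subset
      ((Function.support_mul_subset_right _ _).trans (hsupp a b ha hb))).1 h2
    rw [dom_prod]
    exact h3.mono_measure Measure.restrict_le_self
  have hcs : HasCompactSupport fun p : ℝ × ℝ => α p.1 * β p.2 :=
    HasCompactSupport.of_support_subset_isCompact (hα.compact.prod hβ.compact)
      (hsupp α β hα hβ)
  have hts : tsupport (fun p : ℝ × ℝ => α p.1 * β p.2) ⊆ Ioo 0 t ×ˢ Ioo 0 Λ :=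
    (closure_minimal (hsupp α β hα hβ) (hα.compact.prod hβ.compact).isClosed).trans
      (prod_mono hα.supp hβ.supp)
  have key := h.integral_eq (fun p => α p.1 * β p.2)
    ((hα.smooth.comp contDiff_fst).mul (hβ.smooth.comp contDiff_snd)) hcs hts
  have hd : ∀ p : ℝ × ℝ, deriv (fun s => deriv (fun y => α s * β y) p.2) p.1
      = deriv α p.1 * deriv β p.2 := by
    intro p
    have : (fun s => deriv (fun y => α s * β y) p.2) = fun s => α s * deriv β p.2 := by
      ext s; exact deriv_const_mul _ (hβ.smooth.differentiable (by simp) _)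
    rw [this, deriv_mul_const (hα.smooth.differentiable (by simp) _)]
  simp only [hd] at key
  rw [← dom_prod, integral_prod _ (hint ℓ _ _ hα.deriv hβ.deriv h.locInt),
    integral_prod _ (hint w _ _ hα hβ h.locInt_deriv)] at key
  refine Eq.trans ?_ (key.trans ?_)
  · congr 1; ext s
    rw [← integral_mul_const]
    congr 1; ext y; ring
  · congr 1; ext s
    rw [← integral_mul_const]
    congr 1; ext y; ring

theorem IsTest.hasPrimitive {Λ : ℝ} (hΛ : 0 < Λ) {φ : ℝ → ℝ} (hφ : IsTest Λ φ) :
    HasPrimitive 0 Λ φ (_root_.deriv φ) := HasPrimitive.of_contDiff hΛ.le hφ.smooth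

theorem IsTest.memV {Λ : ℝ} (hΛ : 0 < Λ) {φ : ℝ → ℝ} (hφ : IsTest Λ φ) :
    MemV Λ φ (_root_.deriv φ) :=
  (hφ.hasPrimitive hΛ).memV hΛ (memLp_of_continuousOn hφ.deriv.smooth.continuous.continuousOn)
    (hφ.eq_zero (by simp))

/-- A weak solution with an integrable mixed derivative `w` is obtained from its initial value by
integrating `w`; in particular the initial value satisfies the Dirichlet condition. -/
theorem IsWeakSolutionWith.eq_add_increment {Λ K a a₁ T t : ℝ} {L₀ ℓ₀ : ℝ → ℝ}
    {ℓ dℓ w : ℝ → ℝ → ℝ} (hΛ : 0 < Λ) (ht : 0 < t) (htT : t < T)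
    (h : IsWeakSolutionWith Λ K a a₁ T L₀ ℓ₀ ℓ dℓ) (hm : HasMixedWeakDeriv Λ t ℓ w)
    (hw : Integrable (Function.uncurry w) ((dom t).prod (dom Λ))) {U V : ℝ → ℝ}
    (hU : HasPrimitive 0 Λ U V) (hℓU : ℓ₀ =ᵐ[dom Λ] U) :
    U Λ = 0 ∧ ∀ s ∈ Icc 0 t, ∀ᵐ y ∂(dom Λ), ℓ s y = U y + increment Λ w s y := by
  have hsub : Icc 0 t ⊆ Ico 0 T := fun s hs => ⟨hs.1, hs.2.trans_lt htT⟩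
  have h0t : (0 : ℝ) ∈ Icc 0 t := ⟨le_rfl, ht.le⟩
  have hℓ0 : ℓ 0 =ᵐ[dom Λ] U := h.initial.trans hℓU
  have hℓi : ∀ s ∈ Icc 0 t, LocallyIntegrableOn (ℓ s) (Ioo 0 Λ) volume := fun s hs =>
    locallyIntegrableOn_of_integrable_dom (MemLp.integrable_dom (h.memLp s (hsub hs)))
  have hUi := locallyIntegrableOn_of_integrable_dom (hU.integrable_dom hΛ)
  have hPi : ∀ s ∈ Icc 0 t, LocallyIntegrableOn (increment Λ w s) (Ioo 0 Λ) volume := fun s hs =>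
    locallyIntegrableOn_of_integrable_dom ((hasPrimitive_increment hΛ hs hw).integrable_dom hΛ)
  have hsplit : ∀ s ∈ Icc 0 t, ∀ φ, IsTest Λ φ →
      ∫ y, (ℓ s y - U y - increment Λ w s y) * φ y ∂(dom Λ) = ∫ y, ℓ s y * φ y ∂(dom Λ)
        - ∫ y, U y * φ y ∂(dom Λ) - ∫ y, increment Λ w s y * φ y ∂(dom Λ) := by
    intro s hs φ hφ
    simp only [sub_mul]
    rw [← integral_sub (hφ.integrable_mul (hℓi s hs)) (hφ.integrable_mul hUi)]
    exact integral_sub ((hφ.integrable_mul (hℓi s hs)).sub (hφ.integrable_mul hUi))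
      (hφ.integrable_mul (hPi s hs))
  -- The mixed derivative tested with `α(s) β(y)` identifies the weak time derivative of `∫ ℓ β'`;
  -- weak continuity then gives the integrated identity at every time.
  have hprim : ∀ β, IsTest Λ β → HasPrimitive 0 t (fun s => ∫ y, ℓ s y * deriv β y ∂(dom Λ))
      (fun s => -∫ y, w s y * β y ∂(dom Λ)) := by
    intro β hβ
    have hc : ContinuousOn (fun s => ∫ y, ℓ s y * deriv β y ∂(dom Λ)) (Icc 0 t) :=
      (h.weakCont _ _ (hβ.deriv.memV hΛ)).mono hsub
    have hcl : LocallyIntegrableOn (fun s => ∫ y, ℓ s y * deriv β y ∂(dom Λ)) (Ioo 0 t) volume :=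
      (hc.mono Ioo_subset_Icc_self).locallyIntegrableOn measurableSet_Ioo
    obtain ⟨F, hF, hFe⟩ := exists_hasPrimitive_of_weak_deriv ht hcl
      ((integrable_dom_iff ht.le).2 (intervalIntegrable_integral_mul ht hΛ hw (hβ.hasPrimitive hΛ)))
      (by
        intro α hα
        rw [hm.integral_separated hα hβ]
        simp only [neg_mul, integral_neg, neg_neg])
    refine hF.congr_left ht.le (Measure.eqOn_Icc_of_ae_eq volume ht.ne ?_ hc
      (hF.continuousOn ht.le))
    rw [← restrict_Ioo_eq_restrict_Icc]
    exact hFe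
  have hconst : ∀ s ∈ Icc 0 t, ∃ c, ∀ᵐ y ∂(dom Λ), ℓ s y - U y - increment Λ w s y = c := by
    intro s hs
    refine ae_eq_const_of_integral_deriv_eq_zero hΛ (((hℓi s hs).sub hUi).sub (hPi s hs)) ?_
    intro β hβ
    have h1 := (hprim β hβ).eq s hs
    have h2 : ∫ y, ℓ 0 y * deriv β y ∂(dom Λ) = ∫ y, U y * deriv β y ∂(dom Λ) := by
      refine integral_congr_ae ?_
      filter_upwards [hℓ0] with y hy
      rw [hy]
    refine (hsplit s hs _ hβ.deriv).trans ?_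
    rw [integral_increment_mul hΛ hs hw (hβ.hasPrimitive hΛ) (hβ.eq_zero (by simp)), h1, h2]
    ring
  obtain ⟨ρ, hρ, hρ1⟩ := IsTest.exists_integral_eq_one hΛ
  have hR := HasPrimitive.of_integral (a := 0) (b := Λ)
    (hρ.smooth.continuous.intervalIntegrable (μ := volume) 0 Λ) 0
  set R : ℝ → ℝ := fun x => 0 + ∫ y in (0 : ℝ)..x, ρ y with hRdef
  have hR0 : R 0 = 0 := by simp [hRdef]
  -- The constant left at each time is computed by testing with `ρ`, which shows that it is
  -- continuous in `s`.
  set C : ℝ → ℝ := fun s => ∫ y, ℓ s y * ρ y ∂(dom Λ) - ∫ y, U y * ρ y ∂(dom Λ)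
    - (0 + ∫ r in (0 : ℝ)..s, -∫ y, w r y * R y ∂(dom Λ)) with hC
  have hCc : ContinuousOn C (Icc 0 t) := by
    refine (((h.weakCont _ _ (hρ.memV hΛ)).mono hsub).sub continuousOn_const).sub ?_
    exact (HasPrimitive.of_integral
      (intervalIntegrable_integral_mul ht hΛ hw hR) 0).continuousOn ht.le
  have hCs : ∀ s ∈ Icc 0 t, ∀ᵐ y ∂(dom Λ), ℓ s y - U y - increment Λ w s y = C s := by
    intro s hs
    obtain ⟨c, hc⟩ := hconst s hs
    have h1 := hsplit s hs ρ hρ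
    rw [integral_increment_mul hΛ hs hw hR hR0] at h1
    have h2 : ∫ y, (ℓ s y - U y - increment Λ w s y) * ρ y ∂(dom Λ) = c := by
      rw [integral_congr_ae (g := fun y => c * ρ y) (by
        filter_upwards [hc] with y hy; rw [hy]), integral_const_mul, integral_dom hΛ.le, hρ1,
        mul_one]
    have h3 : c = C s := by rw [← h2, h1, hC]; ring
    rw [← h3]; exact hc
  -- The Dirichlet condition, available at almost every time, fixes the constant; continuity extends
  -- this to every time. At `s = 0` the constant is `0`, which forces `U Λ = 0`.
  have hCU : EqOn C (fun _ => -U Λ) (Icc 0 t) := by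
    refine Measure.eqOn_Icc_of_ae_eq volume ht.ne ?_ hCc continuousOn_const
    rw [← restrict_Ioo_eq_restrict_Icc]
    have hV : ∀ᵐ s ∂(volume.restrict (Ioo 0 t)), MemV Λ (ℓ s) (dℓ s) :=
      ae_restrict_of_ae_restrict_of_subset (Ioo_subset_Ioo_right htT.le) h.memV
    filter_upwards [hV, ae_restrict_mem measurableSet_Ioo] with s hsV hs
    have hs := Ioo_subset_Icc_self hs
    have hP := hasPrimitive_increment hΛ hs hw
    have he : EqOn (fun y => ℓ s y - U y - increment Λ w s y) (fun _ => C s) (Icc 0 Λ) := by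
      refine Measure.eqOn_Icc_of_ae_eq volume hΛ.ne ?_
        ((hsV.continuousOn.sub (hU.continuousOn hΛ.le)).sub (hP.continuousOn hΛ.le))
        continuousOn_const
      rw [← restrict_Ioo_eq_restrict_Icc]
      exact hCs s hs
    have := he (x := Λ) ⟨hΛ.le, le_rfl⟩
    simp only [hsV.dirichlet, increment, tail_self] at this
    linarith
  have hC0 : C 0 = 0 := by
    rw [hC]
    simp only [intervalIntegral.integral_same]
    rw [integral_congr_ae (g := fun y => U y * ρ y) (by
      filter_upwards [hℓ0] with y hy; rw [hy])]
    ring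
  have hUΛ : U Λ = 0 := by
    have := hCU h0t
    rw [hC0] at this
    simpa using this
  refine ⟨hUΛ, fun s hs => ?_⟩
  filter_upwards [hCs s hs] with y hy
  rw [hCU hs, hUΛ] at hy
  linarith

/-! ### The error equation and the energy estimate -/

theorem ae_eq_zero_of_integral_mul_test {t : ℝ} {u : ℝ → ℝ}
    (hu : LocallyIntegrableOn u (Ioo 0 t) volume)
    (h : ∀ φ, IsTest t φ → ∫ s, u s * φ s ∂(dom t) = 0) : ∀ᵐ s ∂(dom t), u s = 0 := by
  have key := isOpen_Ioo.ae_eq_zero_of_integral_contDiff_smul_eq_zero (μ := volume) hu ?_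
  · rw [dom, ae_restrict_iff' measurableSet_Ioo]
    exact key
  · intro φ h1 h2 h3
    have hφ : IsTest t φ := ⟨h1, h2, h3⟩
    rw [← h φ hφ, dom, setIntegral_eq_integral_of_forall_compl_eq_zero]
    · simp only [smul_eq_mul, mul_comm]
    · intro x hx; rw [hφ.eq_zero hx, mul_zero]

section Mesh

variable {Λ K a a₁ t : ℝ} {N : ℕ}

theorem load_eq (hΛ : 0 < Λ) (hN : 1 ≤ N) (L₀ : ℝ → ℝ) (s : ℝ) (i : Fin N) :
    load Λ N L₀ s i = -(Λ / 2) * deriv L₀ s * hat Λ N i 0 := by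
  have h0 := hat_node hΛ hN i 0
  simp only [Nat.cast_zero, zero_mul] at h0
  rw [h0, load]
  split_ifs <;> simp

theorem continuous_load {L₀ : ℝ → ℝ} (hL : ContDiff ℝ 1 L₀) (i : Fin N) :
    Continuous fun s => load Λ N L₀ s i := by
  have := hL.continuous_deriv le_rfl
  unfold load
  split_ifs <;> fun_prop

theorem stiffApply_congr {n n' : ℕ → ℝ} (h : ∀ j ≤ N, n j = n' j) (i : Fin N) :
    stiffApply Λ K a a₁ N n i = stiffApply Λ K a a₁ N n' i := by
  have := i.2
  rw [stiffApply, stiffApply, h i (by omega), h (i - 1) (by omega), h (i + 1) (by omega),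
    h 0 (by omega)]

theorem stiffApply_sub (n n' : ℕ → ℝ) (i : ℕ) :
    stiffApply Λ K a a₁ N (fun j => n j - n' j) i
      = stiffApply Λ K a a₁ N n i - stiffApply Λ K a a₁ N n' i := by
  simp only [stiffApply]; ring

theorem continuousOn_stiffApply {n : ℝ → ℕ → ℝ} {S : Set ℝ}
    (h : ∀ j ≤ N, ContinuousOn (fun s => n s j) S) (i : Fin N) :
    ContinuousOn (fun s => stiffApply Λ K a a₁ N (n s) i) S := by
  have := i.2
  have h1 := h i (by omega)
  have h2 := h (i - 1) (by omega)
  have h3 := h (i + 1) (by omega)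
  have h4 := h 0 (by omega)
  unfold stiffApply
  fun_prop

/-- The weak formulation tested with a hat function, at almost every time. -/
theorem IsWeakSolutionWith.ae_hat_equation {L₀ ℓ₀ : ℝ → ℝ} {ℓ dℓ w : ℝ → ℝ → ℝ} (hΛ : 0 < Λ)
    (ht : 0 < t) (hN : 1 ≤ N) (h : IsWeakSolutionWith Λ K a a₁ t L₀ ℓ₀ ℓ dℓ)
    (hL : ContDiff ℝ 1 L₀)
    (hw : Integrable (Function.uncurry w) ((dom t).prod (dom Λ))) {U V : ℝ → ℝ}
    (hU : HasPrimitive 0 Λ U V)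
    (hrep : ∀ s ∈ Icc 0 t, ∀ᵐ y ∂(dom Λ), ℓ s y = U y + increment Λ w s y) (i : Fin N) :
    ∀ᵐ s ∂(dom t), ∫ y, tail Λ (w s) y * hat Λ N i y ∂(dom Λ)
      + stiffApply Λ K a a₁ N (fun j => U (j * mesh Λ N) + increment Λ w s (j * mesh Λ N)) i
      = load Λ N L₀ s i := by
  have hc := continuous_hat Λ N i
  have hH := HasPrimitive.of_integral (a := 0) (b := Λ)
    (hc.intervalIntegrable (μ := volume) 0 Λ) 0
  set H : ℝ → ℝ := fun x => 0 + ∫ y in (0 : ℝ)..x, hat Λ N i y with hHdef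
  have hH0 : H 0 = 0 := by simp [hHdef]
  have hGi := intervalIntegrable_integral_mul ht hΛ hw hH
  set G : ℝ → ℝ := fun r => -∫ y, w r y * H y ∂(dom Λ) with hG
  have hF := HasPrimitive.of_integral hGi (∫ y, U y * hat Λ N i y ∂(dom Λ))
  have hci : ∀ f : ℝ → ℝ, ContinuousOn f (Icc 0 Λ) →
      Integrable (fun y => f y * hat Λ N i y) (dom Λ) := fun f hf =>
    (memLp_of_continuousOn (hf.mul hc.continuousOn)).integrable (by norm_num)
  -- Pairing the increment with the hat through its primitive `H` exhibits `∫ ℓ Φ_i` as absolutely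
  -- continuous in time, so the distributional equation becomes an identity between locally
  -- integrable functions of `s`.
  have hFe : ∀ s ∈ Icc 0 t, ∫ y, ℓ s y * hat Λ N i y ∂(dom Λ)
      = (∫ y, U y * hat Λ N i y ∂(dom Λ)) + ∫ r in (0 : ℝ)..s, G r := by
    intro s hs
    rw [← integral_increment_mul hΛ hs hw hH hH0, ← integral_add
      (hci _ (hU.continuousOn hΛ.le))
      (hci _ ((hasPrimitive_increment hΛ hs hw).continuousOn hΛ.le))]
    refine integral_congr_ae ?_
    filter_upwards [hrep s hs] with y hy
    rw [hy]; ring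
  set κ : ℝ → ℝ := fun s =>
    stiffApply Λ K a a₁ N (fun j => U (j * mesh Λ N) + increment Λ w s (j * mesh Λ N)) i with hκ
  have hκc : ContinuousOn κ (Icc 0 t) := by
    refine continuousOn_stiffApply (fun j hj => ?_) i
    exact continuousOn_const.add ((hasPrimitive_increment_time ht hw
      (node_mem hΛ hN hj)).continuousOn ht.le)
  have hκe : ∀ᵐ s ∂(dom t),
      kappa Λ K a a₁ (ℓ s) (dℓ s) (hat Λ N i) (deriv (hat Λ N i)) = κ s := by
    filter_upwards [h.memV, ae_restrict_mem measurableSet_Ioo] with s hsV hs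
    have hs := Ioo_subset_Icc_self hs
    rw [kappa_hat hΛ hN K a a₁ (hsV.hasPrimitive hΛ) i]
    have he : EqOn (ℓ s) (fun y => U y + increment Λ w s y) (Icc 0 Λ) := by
      refine Measure.eqOn_Icc_of_ae_eq volume hΛ.ne ?_ hsV.continuousOn
        ((hU.continuousOn hΛ.le).add ((hasPrimitive_increment hΛ hs hw).continuousOn hΛ.le))
      rw [← restrict_Ioo_eq_restrict_Icc]
      exact hrep s hs
    exact stiffApply_congr (fun j hj => he (node_mem hΛ hN hj)) i
  have hlc := continuous_load (Λ := Λ) hL i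
  have hGl : LocallyIntegrableOn G (Ioo 0 t) volume :=
    locallyIntegrableOn_of_integrable_dom ((integrable_dom_iff ht.le).2 hGi)
  have hκl : LocallyIntegrableOn κ (Ioo 0 t) volume :=
    (hκc.mono Ioo_subset_Icc_self).locallyIntegrableOn measurableSet_Ioo
  have hll : LocallyIntegrableOn (fun s => load Λ N L₀ s i) (Ioo 0 t) volume :=
    hlc.continuousOn.locallyIntegrableOn measurableSet_Ioo
  have hae := ae_eq_zero_of_integral_mul_test ((hGl.add hκl).sub hll) (by
    intro φ hφ
    have heq := h.equation _ _ (memV_hat hΛ hN i) φ hφ.smooth hφ.compact hφ.supp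
    change -(∫ s, _ ∂(dom t)) + ∫ s, _ ∂(dom t) = ∫ s, _ ∂(dom t) at heq
    have e1 : ∫ s, deriv φ s * ∫ y, ℓ s y * hat Λ N i y ∂(dom Λ) ∂(dom t)
        = -∫ s, G s * φ s ∂(dom t) := by
      rw [← hF.integral_mul_deriv_test ht hφ]
      refine integral_congr_ae ?_
      filter_upwards [ae_restrict_mem measurableSet_Ioo] with s hs
      rw [hFe s (Ioo_subset_Icc_self hs), mul_comm]
    have e2 : ∫ s, φ s * kappa Λ K a a₁ (ℓ s) (dℓ s) (hat Λ N i) (deriv (hat Λ N i)) ∂(dom t)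
        = ∫ s, κ s * φ s ∂(dom t) := by
      refine integral_congr_ae ?_
      filter_upwards [hκe] with s hs
      rw [hs, mul_comm]
    have e3 : ∫ s, φ s * (-(Λ / 2) * deriv L₀ s * hat Λ N i 0) ∂(dom t)
        = ∫ s, load Λ N L₀ s i * φ s ∂(dom t) := by
      congr 1; ext s; rw [load_eq hΛ hN, mul_comm]
    rw [e1, e2, e3, neg_neg, ← integral_add (hφ.integrable_mul hGl) (hφ.integrable_mul hκl)] at heq
    simp only [Pi.add_apply, Pi.sub_apply, sub_mul, add_mul]
    rw [← sub_eq_zero] at heq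
    rw [← heq]
    exact integral_sub ((hφ.integrable_mul hGl).add (hφ.integrable_mul hκl))
      (hφ.integrable_mul hll))
  filter_upwards [hae, hw.prod_right_ae] with s hs hws
  rw [integral_tail_mul (f := w s) hΛ hws hH hH0]
  exact sub_eq_zero.1 hs

theorem continuousOn_nodal {c : ℝ → Fin N → ℝ} {S : Set ℝ} (hc : ContinuousOn c S) (j : ℕ) :
    ContinuousOn (fun s => nodal (c s) j) S := by
  unfold nodal
  split_ifs with hj
  · exact continuousOn_pi.1 hc _
  · exact continuousOn_const

/-- The differential equation is only assumed for positive times; continuity at `0` lets the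
integrated form start there. -/
theorem IsLumpedSolution.hasPrimitive {L₀ : ℝ → ℝ} {c : ℝ → Fin N → ℝ} (hΛ : 0 < Λ) (hN : 1 ≤ N)
    (h : IsLumpedSolution Λ K a a₁ N L₀ c) (hL : ContDiff ℝ 1 L₀) (ht : 0 ≤ t) (i : Fin N) :
    HasPrimitive 0 t (fun s => mesh Λ N * c s i)
      (fun s => load Λ N L₀ s i - stiffApply Λ K a a₁ N (nodal (c s)) i) := by
  have hcont : ContinuousOn c (Icc 0 t) := h.continuousOn.mono Icc_subset_Ici_self
  have hint : ContinuousOn (fun s => load Λ N L₀ s i - stiffApply Λ K a a₁ N (nodal (c s)) i)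
      (Icc 0 t) :=
    (continuous_load hL i).continuousOn.sub
      (continuousOn_stiffApply (fun j _ => continuousOn_nodal hcont j) i)
  have hd : ∀ s > 0, HasDerivAt (fun s => mesh Λ N * c s i)
      (load Λ N L₀ s i - stiffApply Λ K a a₁ N (nodal (c s)) i) s := by
    intro s hs
    have h1 := hasDerivAt_pi.1 (h.ode s hs) i
    rw [Pi.sub_apply, stiffness_mulVec hΛ hN] at h1
    refine h1.congr_of_eventuallyEq (.of_forall fun r => ?_)
    simp only [lumpedMass, Matrix.mulVec_diagonal]
  refine ⟨(hint.mono (by rw [uIcc_of_le ht])).intervalIntegrable, fun s hs => ?_⟩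
  have hsub : Icc 0 s ⊆ Icc 0 t := Icc_subset_Icc_right hs.2
  rw [intervalIntegral.integral_eq_sub_of_hasDerivAt_of_le hs.1
    (continuousOn_const.mul ((continuousOn_pi.1 hcont i).mono hsub)) (fun r hr => hd r hr.1)
    ((hint.mono hsub).mono (by rw [uIcc_of_le hs.1])).intervalIntegrable]
  simp only [Pi.mul_apply]
  ring

theorem HasPrimitive.sq_sub_sq {F f : ℝ → ℝ} (ht : 0 ≤ t) (hF : HasPrimitive 0 t F f) :
    F t ^ 2 - F 0 ^ 2 = 2 * ∫ s in (0 : ℝ)..t, F s * f s := by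
  have h1 := hF.integral_mul ht hF
  have h2 : ∫ s in (0 : ℝ)..t, f s * F s = ∫ s in (0 : ℝ)..t, F s * f s := by
    simp only [mul_comm]
  rw [h2] at h1
  linarith

/-- The energy estimate for the difference between the discrete solution and the nodal values of
the weak solution. -/
theorem energy_estimate {L₀ ℓ₀ : ℝ → ℝ} {ℓ dℓ w : ℝ → ℝ → ℝ} {c : ℝ → Fin N → ℝ} (hΛ : 0 < Λ)
    (hK : 0 < K) (ha : 0 < a) (ha₁ : 0 < a₁)
    (ht : 0 < t) (hN : 1 ≤ N) (h : IsWeakSolutionWith Λ K a a₁ t L₀ ℓ₀ ℓ dℓ)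
    (hL : ContDiff ℝ 1 L₀) (hc : IsLumpedSolution Λ K a a₁ N L₀ c)
    (hw : MemLp (Function.uncurry w) 2 ((dom t).prod (dom Λ))) {U V : ℝ → ℝ}
    (hU : HasPrimitive 0 Λ U V) (hU0 : U Λ = 0)
    (hrep : ∀ s ∈ Icc 0 t, ∀ᵐ y ∂(dom Λ), ℓ s y = U y + increment Λ w s y) :
    mesh Λ N * ∑ i : Fin N,
        (c t i - (U (i * mesh Λ N) + increment Λ w t (i * mesh Λ N))) ^ 2
      ≤ mesh Λ N * ∑ i : Fin N, (c 0 i - U (i * mesh Λ N)) ^ 2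
        + 2 / K * mesh Λ N ^ 2 * ∫ s, ∫ y, w s y ^ 2 ∂(dom Λ) ∂(dom t) := by
  have hm := mesh_pos hΛ hN
  have hwi : Integrable (Function.uncurry w) ((dom t).prod (dom Λ)) := hw.integrable (by norm_num)
  have hw2 : Integrable (fun p : ℝ × ℝ => w p.1 p.2 ^ 2) ((dom t).prod (dom Λ)) :=
    hw.integrable_sq
  set θ : ℝ → Fin N → ℝ := fun s i =>
    c s i - (U (i * mesh Λ N) + increment Λ w s (i * mesh Λ N)) with hθ
  set g : Fin N → ℝ → ℝ := fun i s => load Λ N L₀ s i - stiffApply Λ K a a₁ N (nodal (c s)) i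
    - mesh Λ N * tail Λ (w s) (i * mesh Λ N) with hg
  have hprim : ∀ i, HasPrimitive 0 t (fun s => mesh Λ N * θ s i) (g i) := by
    intro i
    have h1 := hc.hasPrimitive hΛ hN hL ht.le i
    have h2 := hasPrimitive_increment_time ht hwi (node_mem hΛ hN i.2.le)
    refine ⟨h1.int.sub (h2.int.const_mul _), fun s hs => ?_⟩
    have ht0 : (0 : ℝ) ∈ Icc 0 t := ⟨le_rfl, ht.le⟩
    rw [hg, intervalIntegral.integral_sub (h1.int_mono ht0 hs) ((h2.int_mono ht0 hs).const_mul _),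
      intervalIntegral.integral_const_mul, ← h1.sub_eq ht0 hs, ← h2.sub_eq ht0 hs]
    simp only [hθ]; ring
  have hinc0 : ∀ y, increment Λ w 0 y = 0 := fun y => by simp [increment, tail]
  have hbound : ∀ᵐ s ∂(dom t), ∑ i, θ s i * g i s
      ≤ mesh Λ N ^ 2 / K * ∫ y, w s y ^ 2 ∂(dom Λ) := by
    have heq := ae_all_iff.2 fun i => h.ae_hat_equation hΛ ht hN hL hwi hU hrep i
    filter_upwards [heq, hwi.prod_right_ae, hw2.prod_right_ae, hw.1.prodMk_left,
      ae_restrict_mem measurableSet_Ioo] with s hs h1 h2 h3 hst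
    have hst := Ioo_subset_Icc_self hst
    have hwL : MemLp (w s) 2 (dom Λ) := (memLp_two_iff_integrable_sq h3).2 h2
    have key := consistency_sub_dissipation_le hΛ hN hK ha ha₁ (hasPrimitive_tail (f := w s) hΛ h1)
      (tail_self Λ (w s)) hwL (θ s)
    refine le_trans (le_of_eq ?_) key
    refine Finset.sum_congr rfl fun i _ => ?_
    have hnod : stiffApply Λ K a a₁ N (nodal (θ s)) i = stiffApply Λ K a a₁ N (nodal (c s)) i
        - stiffApply Λ K a a₁ N
          (fun j => U (j * mesh Λ N) + increment Λ w s (j * mesh Λ N)) i := by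
      rw [← stiffApply_sub]
      refine stiffApply_congr (fun j hj => ?_) i
      rcases hj.lt_or_eq with hj | rfl
      · simp [nodal, hj, hθ]
      · rw [nodal_last, nodal_last, natCast_mul_mesh hN, hU0, increment, tail_self]; ring
    rw [hnod, hg]
    dsimp only
    rw [← hs i]
    ring
  have hsum : ∑ i, ((mesh Λ N * θ t i) ^ 2 - (mesh Λ N * θ 0 i) ^ 2)
      ≤ 2 * (mesh Λ N * (mesh Λ N ^ 2 / K * ∫ s, ∫ y, w s y ^ 2 ∂(dom Λ) ∂(dom t))) := by
    rw [Finset.sum_congr rfl fun i _ => (hprim i).sq_sub_sq ht.le, ← Finset.mul_sum]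
    gcongr
    rw [← intervalIntegral.integral_finsetSum fun i _ =>
      (hprim i).integrable_mul ht.le (hprim i).int, ← integral_dom ht.le, ← integral_const_mul,
      ← integral_const_mul]
    refine integral_mono_ae ?_ ((hw2.integral_prod_left.const_mul _).const_mul _) ?_
    · refine integrable_finsetSum _ fun i _ => ?_
      exact (integrable_dom_iff ht.le).2 ((hprim i).integrable_mul ht.le (hprim i).int)
    · filter_upwards [hbound] with s hs
      simp only [mul_assoc]
      rw [← Finset.mul_sum]
      exact mul_le_mul_of_nonneg_left hs hm.le
  -- The primitives carried `h θ_i`, so their squares have one factor `h` too many; it is cancelled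
  -- at the end.
  have hfin : mesh Λ N * (mesh Λ N * ∑ i, θ t i ^ 2) ≤ mesh Λ N * (mesh Λ N * ∑ i, θ 0 i ^ 2
      + 2 / K * mesh Λ N ^ 2 * ∫ s, ∫ y, w s y ^ 2 ∂(dom Λ) ∂(dom t)) := by
    rw [Finset.sum_sub_distrib] at hsum
    simp only [mul_pow, ← Finset.mul_sum] at hsum
    have : 2 * (mesh Λ N * (mesh Λ N ^ 2 / K * ∫ s, ∫ y, w s y ^ 2 ∂(dom Λ) ∂(dom t)))
      = mesh Λ N * (2 / K * mesh Λ N ^ 2 * ∫ s, ∫ y, w s y ^ 2 ∂(dom Λ) ∂(dom t)) := by ring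
    nlinarith
  have := le_of_mul_le_mul_left hfin hm
  simpa only [hθ, hinc0, add_zero] using this

end Mesh

/-! ### The error estimate -/

theorem lintegral_normL2_sq {t Λ : ℝ} {w : ℝ → ℝ → ℝ}
    (hw : AEStronglyMeasurable (Function.uncurry w) ((dom t).prod (dom Λ))) :
    ∫⁻ s in Ioo 0 t, normL2 Λ (w s) ^ 2
      = ∫⁻ p, ‖Function.uncurry w p‖ₑ ^ 2 ∂((dom t).prod (dom Λ)) := by
  simp_rw [normL2_sq]
  rw [lintegral_prod _ (hw.enorm.pow_const 2)]
  rfl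

theorem lintegral_normL2_sq_eq_ofReal {t Λ : ℝ} {w : ℝ → ℝ → ℝ}
    (hw : MemLp (Function.uncurry w) 2 ((dom t).prod (dom Λ))) :
    ∫⁻ s in Ioo 0 t, normL2 Λ (w s) ^ 2
      = ENNReal.ofReal (∫ s, ∫ y, w s y ^ 2 ∂(dom Λ) ∂(dom t)) := by
  have hw2 : Integrable (fun p : ℝ × ℝ => w p.1 p.2 ^ 2) ((dom t).prod (dom Λ)) :=
    hw.integrable_sq
  rw [lintegral_normL2_sq hw.1, ← integral_prod _ hw2,
    ofReal_integral_eq_lintegral_ofReal hw2 (.of_forall fun p => sq_nonneg _)]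
  refine lintegral_congr fun p => ?_
  rw [Real.enorm_eq_ofReal_abs, ← ENNReal.ofReal_pow (abs_nonneg _), sq_abs]
  rfl

theorem memLp_of_lintegral_normL2_sq_ne_top {t Λ : ℝ} {w : ℝ → ℝ → ℝ}
    (hw : AEStronglyMeasurable (Function.uncurry w) ((dom t).prod (dom Λ)))
    (h : ∫⁻ s in Ioo 0 t, normL2 Λ (w s) ^ 2 ≠ ⊤) :
    MemLp (Function.uncurry w) 2 ((dom t).prod (dom Λ)) := by
  refine ⟨hw, ?_⟩
  rw [lintegral_normL2_sq hw] at h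
  refine (eLpNorm_lt_top_iff_lintegral_rpow_enorm_lt_top two_ne_zero ENNReal.ofNat_ne_top).2 ?_
  simpa using h.lt_top

theorem normL2_congr {Λ : ℝ} {f g : ℝ → ℝ} (h : f =ᵐ[dom Λ] g) : normL2 Λ f = normL2 Λ g :=
  eLpNorm_congr_ae h

theorem p1_sub (Λ : ℝ) (N : ℕ) (c d : Fin N → ℝ) (y : ℝ) :
    p1 Λ N (fun i => c i - d i) y = p1 Λ N c y - p1 Λ N d y := by
  simp only [p1, sub_mul, Finset.sum_sub_distrib]

theorem normL2_p1_sub_le {Λ : ℝ} {N : ℕ} (hΛ : 0 < Λ) (hN : 1 ≤ N) {u v g : ℝ → ℝ}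
    (hu : HasPrimitive 0 Λ u v) (hv : HasPrimitive 0 Λ v g) (hg : MemLp g 2 (dom Λ))
    (h0 : u Λ = 0) :
    normL2 Λ (fun y => p1 Λ N (fun i => u (i * mesh Λ N)) y - u y)
      ≤ ENNReal.ofReal (mesh Λ N) ^ 2 * normL2 Λ g := by
  have hm := mesh_pos hΛ hN
  have hL : MemLp (fun y => p1 Λ N (fun i => u (i * mesh Λ N)) y - u y) 2 (dom Λ) :=
    memLp_of_continuousOn ((continuous_p1 Λ N _).continuousOn.sub (hu.continuousOn hΛ.le))
  rw [normL2_eq_ofReal hL, normL2_eq_ofReal hg,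
    ← ENNReal.ofReal_pow hm.le, ← ENNReal.ofReal_mul (by positivity)]
  refine ENNReal.ofReal_le_ofReal ?_
  refine Real.sqrt_le_iff.2 ⟨by positivity, ?_⟩
  rw [mul_pow, Real.sq_sqrt (integral_nonneg fun y => sq_nonneg _), ← pow_mul]
  exact integral_sub_p1_sq_le hΛ hN hu hv hg h0

/-- The error estimate at positive times, when the data are square integrable. -/
theorem error_estimate {Λ K a a₁ t : ℝ} {N : ℕ} {L₀ ℓ₀ : ℝ → ℝ} {ℓ w : ℝ → ℝ → ℝ}
    {c : ℝ → Fin N → ℝ} {g₀ g : ℝ → ℝ} (hΛ : 0 < Λ) (hK : 0 < K) (ha : 0 < a) (ha₁ : 0 < a₁)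
    (ht : 0 < t) (hN : 1 ≤ N) (hℓ : ∀ T > 0, IsWeakSolution Λ K a a₁ T L₀ ℓ₀ ℓ)
    (hL : ContDiff ℝ 1 L₀) (hc : IsLumpedSolution Λ K a a₁ N L₀ c)
    (hg₀ : HasWeakDeriv Λ 2 ℓ₀ g₀) (hg : HasWeakDeriv Λ 2 (ℓ t) g)
    (hm : HasMixedWeakDeriv Λ t ℓ w) (hg₀L : MemLp g₀ 2 (dom Λ)) (hgL : MemLp g 2 (dom Λ))
    (hwL : MemLp (Function.uncurry w) 2 ((dom t).prod (dom Λ))) :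
    normL2 Λ (fun y => p1 Λ N (c t) y - ℓ t y)
      ≤ 3 * (normL2 Λ (fun y => p1 Λ N (c 0) y - ℓ₀ y)
          + ENNReal.ofReal (mesh Λ N) ^ 2 * normL2 Λ g₀)
        + ENNReal.ofReal (2 / √K) * (ENNReal.ofReal (mesh Λ N)
            * (∫⁻ s in Ioo 0 t, normL2 Λ (w s) ^ 2) ^ (1 / 2 : ℝ))
        + ENNReal.ofReal (mesh Λ N) ^ 2 * normL2 Λ g := by
  have hmesh := mesh_pos hΛ hN
  have hwi : Integrable (Function.uncurry w) ((dom t).prod (dom Λ)) :=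
    hwL.integrable (by norm_num)
  obtain ⟨U₀, V₀, hU₀, hV₀, he₀⟩ := hg₀.exists_hasPrimitive_two hΛ (MemLp.integrable_dom hg₀L)
  obtain ⟨U, V, hU, hV, he⟩ := hg.exists_hasPrimitive_two hΛ (MemLp.integrable_dom hgL)
  -- A longer time interval is needed here because membership in `L²` and weak continuity are given
  -- on `[0, T)` only, and `t` itself must be included.
  obtain ⟨dℓ', h'⟩ := hℓ (t + 1) (by positivity)
  obtain ⟨dℓ, h⟩ := hℓ t ht
  obtain ⟨hU₀Λ, hrep⟩ := h'.eq_add_increment hΛ ht (by linarith) hm hwi hU₀ he₀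
  have htt : t ∈ Icc 0 t := ⟨ht.le, le_rfl⟩
  have hUe : EqOn U (fun y => U₀ y + increment Λ w t y) (Icc 0 Λ) := by
    refine Measure.eqOn_Icc_of_ae_eq volume hΛ.ne ?_ (hU.continuousOn hΛ.le)
      ((hU₀.continuousOn hΛ.le).add ((hasPrimitive_increment hΛ htt hwi).continuousOn hΛ.le))
    rw [← restrict_Ioo_eq_restrict_Icc]
    exact he.symm.trans (hrep t htt)
  have hUΛ : U Λ = 0 := by
    rw [hUe ⟨hΛ.le, le_rfl⟩]
    simp only [increment, tail_self, hU₀Λ, add_zero]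
  have hen := energy_estimate hΛ hK ha ha₁ ht hN h hL hc hwL hU₀ hU₀Λ hrep
  set θ : Fin N → ℝ := fun i => c t i - U (i * mesh Λ N) with hθ
  set θ₀ : Fin N → ℝ := fun i => c 0 i - U₀ (i * mesh Λ N) with hθ₀
  have hsum : ∑ i : Fin N, (c t i - (U₀ (i * mesh Λ N) + increment Λ w t (i * mesh Λ N))) ^ 2
      = ∑ i, θ i ^ 2 := by
    refine Finset.sum_congr rfl fun i _ => ?_
    rw [hθ]
    dsimp only
    rw [hUe (node_mem hΛ hN i.2.le)]
  rw [hsum] at hen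
  have hcp : ∀ d, MemLp (p1 Λ N d) 2 (dom Λ) := fun d =>
    memLp_of_continuousOn (continuous_p1 Λ N d).continuousOn
  have hJ := lintegral_normL2_sq_eq_ofReal hwL
  set J := ∫ s, ∫ y, w s y ^ 2 ∂(dom Λ) ∂(dom t) with hJdef
  have hJ0 : 0 ≤ J := integral_nonneg fun s => integral_nonneg fun y => sq_nonneg _
  have hθt : normL2 Λ (p1 Λ N θ) ≤ 3 * normL2 Λ (p1 Λ N θ₀)
      + ENNReal.ofReal (2 / √K) * (ENNReal.ofReal (mesh Λ N)
            * (∫⁻ s in Ioo 0 t, normL2 Λ (w s) ^ 2) ^ (1 / 2 : ℝ)) := by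
    have h1 := integral_p1_sq_le hΛ hN θ
    have h2 := le_integral_p1_sq hΛ hN θ₀
    rw [normL2_eq_ofReal (hcp θ), normL2_eq_ofReal (hcp θ₀), hJ,
      ENNReal.ofReal_rpow_of_nonneg hJ0 (by norm_num), ← Real.sqrt_eq_rpow,
      ← ENNReal.ofReal_mul hmesh.le, ← ENNReal.ofReal_mul (by positivity),
      show (3 : ℝ≥0∞) = ENNReal.ofReal 3 by simp, ← ENNReal.ofReal_mul (by norm_num),
      ← ENNReal.ofReal_add (by positivity) (by positivity)]
    refine ENNReal.ofReal_le_ofReal ?_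
    refine Real.sqrt_le_iff.2 ⟨by positivity, ?_⟩
    set A := ∫ y, p1 Λ N θ₀ y ^ 2 ∂(dom Λ)
    have hA : 0 ≤ A := integral_nonneg fun y => sq_nonneg _
    have e1 : (2 / √K * (mesh Λ N * √J)) ^ 2 = 2 * (2 / K * mesh Λ N ^ 2 * J) := by
      rw [mul_pow, div_pow, mul_pow, Real.sq_sqrt hK.le, Real.sq_sqrt hJ0]; ring
    have e2 : 0 ≤ 3 * √A * (2 / √K * (mesh Λ N * √J)) := by positivity
    have e3 : (3 * √A) ^ 2 = 9 * A := by rw [mul_pow, Real.sq_sqrt hA]; norm_num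
    -- The chain `2 (4A + (2/K) h² J) = 8A + (4/K) h² J ≤ (3√A + (2/√K) h √J)²` explains the
    -- constants `3` and `2/√K`.
    nlinarith
  have hθ₀' : normL2 Λ (p1 Λ N θ₀) ≤ normL2 Λ (fun y => p1 Λ N (c 0) y - ℓ₀ y)
      + ENNReal.ofReal (mesh Λ N) ^ 2 * normL2 Λ g₀ := by
    have hi := normL2_p1_sub_le hΛ hN hU₀ hV₀ hg₀L hU₀Λ
    refine le_trans ?_ (add_le_add_right hi _)
    rw [normL2_congr (f := fun y => p1 Λ N (c 0) y - ℓ₀ y)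
      (g := fun y => p1 Λ N (c 0) y - U₀ y) (by filter_upwards [he₀] with y hy; rw [hy])]
    have : p1 Λ N θ₀ = (fun y => p1 Λ N (c 0) y - U₀ y)
        - fun y => p1 Λ N (fun i => U₀ (i * mesh Λ N)) y - U₀ y := by
      ext y; rw [hθ₀, p1_sub, Pi.sub_apply]; ring
    rw [this]
    have hm1 : ∀ d, AEStronglyMeasurable (fun y => p1 Λ N d y - U₀ y) (dom Λ) := fun d =>
      (hcp d).1.sub (hU₀.aestronglyMeasurable hΛ)
    exact eLpNorm_sub_le (hm1 _) (hm1 _) (by norm_num)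
  have hfin : normL2 Λ (fun y => p1 Λ N (c t) y - ℓ t y)
      ≤ normL2 Λ (p1 Λ N θ) + ENNReal.ofReal (mesh Λ N) ^ 2 * normL2 Λ g := by
    have hi := normL2_p1_sub_le hΛ hN hU hV hgL hUΛ
    refine le_trans ?_ (add_le_add_right hi _)
    rw [normL2_congr (f := fun y => p1 Λ N (c t) y - ℓ t y)
      (g := p1 Λ N θ + fun y => p1 Λ N (fun i => U (i * mesh Λ N)) y - U y) (by
        filter_upwards [he] with y hy; rw [hy, Pi.add_apply, hθ, p1_sub]; ring)]
    exact eLpNorm_add_le (hcp _).1 ((hcp _).1.sub (hU.aestronglyMeasurable hΛ)) (by norm_num)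
  refine hfin.trans (add_le_add_left (hθt.trans ?_) _)
  gcongr

end Swimmer

/-! ### Choice of the constant, the initial time and infinite right-hand sides -/

theorem theorem1 (Λ K a a₁ : ℝ) (hΛ : 0 < Λ) (hK : 0 < K) (ha : 0 < a) (ha₁ : 0 < a₁) :
    (∀ (N : ℕ), 1 ≤ N → ∀ (L₀ : ℝ → ℝ) (x : ℕ → ℝ → ℝ),
      Swimmer.IsSpringSolution Λ K a a₁ N L₀ x ↔
        ((∀ t ≥ 0, x (N + 1) t = 0) ∧
          Swimmer.IsLumpedSolution Λ K a a₁ N L₀ (fun t (i : Fin N) => x ((i : ℕ) + 1) t))) ∧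
    ∃ C : ℝ≥0, 0 < C ∧
      ∀ (L₀ : ℝ → ℝ), ContDiff ℝ 1 L₀ →
      ∀ (ℓ₀ : ℝ → ℝ) (ℓ : ℝ → ℝ → ℝ), Swimmer.MemH Λ 2 ℓ₀ →
      (∀ T > 0, Swimmer.IsWeakSolution Λ K a a₁ T L₀ ℓ₀ ℓ) →
      ∀ (N : ℕ), 1 ≤ N →
      ∀ (c₀ : Fin N → ℝ) (c : ℝ → Fin N → ℝ),
      Swimmer.IsLumpedSolution Λ K a a₁ N L₀ c → c 0 = c₀ →
      ∀ t ≥ 0, ∀ (ddℓ₀ ddℓt : ℝ → ℝ) (w : ℝ → ℝ → ℝ),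
      Swimmer.HasWeakDeriv Λ 2 ℓ₀ ddℓ₀ →
      Swimmer.HasWeakDeriv Λ 2 (ℓ t) ddℓt →
      Swimmer.HasMixedWeakDeriv Λ t ℓ w →
        Swimmer.normL2 Λ (fun y => Swimmer.p1 Λ N (c t) y - ℓ t y) ≤
          C * Swimmer.normL2 Λ (fun y => Swimmer.p1 Λ N c₀ y - ℓ₀ y)
          + C * ENNReal.ofReal (Swimmer.mesh Λ N) ^ 2
              * (Swimmer.normL2 Λ ddℓ₀ + Swimmer.normL2 Λ ddℓt)
          + C * ENNReal.ofReal (Swimmer.mesh Λ N)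
              * (∫⁻ s in Ioo 0 t, Swimmer.normL2 Λ (w s) ^ 2) ^ (1 / 2 : ℝ) := by
  refine ⟨fun N hN L₀ x => Swimmer.isSpringSolution_iff hΛ hN L₀ x,
    4 + (2 / √K).toNNReal, by positivity, ?_⟩
  intro L₀ hL ℓ₀ ℓ _ hℓ N hN c₀ c hc hc₀ t ht g₀ g w hg₀ hg hm
  have hmesh : ENNReal.ofReal (Swimmer.mesh Λ N) ≠ 0 := by
    simpa using Swimmer.mesh_pos hΛ hN
  rw [ENNReal.coe_add]
  change _ ≤ (4 + ENNReal.ofReal (2 / √K)) * _ + (4 + ENNReal.ofReal (2 / √K)) * _ * _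
    + (4 + ENNReal.ofReal (2 / √K)) * _ * _
  set C : ℝ≥0∞ := 4 + ENNReal.ofReal (2 / √K) with hC
  have hC4 : 4 ≤ C := le_self_add
  have hC0 : C ≠ 0 := (lt_of_lt_of_le (by norm_num) hC4).ne'
  have hC1 : 1 ≤ C := le_trans (by norm_num) hC4
  subst hc₀
  rcases ht.eq_or_lt with rfl | ht
  · obtain ⟨dℓ, h⟩ := hℓ 1 one_pos
    rw [Swimmer.normL2_congr (f := fun y => Swimmer.p1 Λ N (c 0) y - ℓ 0 y)
      (g := fun y => Swimmer.p1 Λ N (c 0) y - ℓ₀ y) (by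
        filter_upwards [h.initial] with y hy; rw [hy]), add_assoc]
    exact le_add_right (le_mul_of_one_le_left (by positivity) hC1)
  have hmeas : ∀ {u : ℝ → ℝ}, LocallyIntegrableOn u (Ioo 0 Λ) volume →
      AEStronglyMeasurable u (Swimmer.dom Λ) := fun h => h.aestronglyMeasurable
  have hw : AEStronglyMeasurable (Function.uncurry w)
      ((Swimmer.dom t).prod (Swimmer.dom Λ)) := by
    rw [Swimmer.dom_prod]; exact hm.locInt_deriv.aestronglyMeasurable
  -- In `ℝ≥0∞` one has `0 * ⊤ = 0`, so the factors must be nonzero for a norm that is not finite to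
  -- make the right-hand side infinite.
  have hCm : C * ENNReal.ofReal (Swimmer.mesh Λ N) ^ 2 ≠ 0 := mul_ne_zero hC0 (pow_ne_zero 2 hmesh)
  by_cases hg₀L : Swimmer.normL2 Λ g₀ = ⊤
  · rw [hg₀L, top_add, ENNReal.mul_top hCm]; simp
  by_cases hgL : Swimmer.normL2 Λ g = ⊤
  · rw [hgL, add_top, ENNReal.mul_top hCm]; simp
  by_cases hwL : ∫⁻ s in Ioo 0 t, Swimmer.normL2 Λ (w s) ^ 2 = ⊤
  · rw [hwL, ENNReal.top_rpow_of_pos (by norm_num), ENNReal.mul_top (mul_ne_zero hC0 hmesh)]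
    simp
  refine (Swimmer.error_estimate hΛ hK ha ha₁ ht hN hℓ hL hc hg₀ hg hm
    ⟨hmeas hg₀.locInt_deriv, lt_top_iff_ne_top.2 hg₀L⟩
    ⟨hmeas hg.locInt_deriv, lt_top_iff_ne_top.2 hgL⟩
    (Swimmer.memLp_of_lintegral_normL2_sq_ne_top hw hwL)).trans ?_
  have hC3 : 3 ≤ C := le_trans (by norm_num) hC4
  have hCK : ENNReal.ofReal (2 / √K) ≤ C := le_add_self
  calc _ ≤ C * (Swimmer.normL2 Λ (fun y => Swimmer.p1 Λ N (c 0) y - ℓ₀ y)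
          + ENNReal.ofReal (Swimmer.mesh Λ N) ^ 2 * Swimmer.normL2 Λ g₀)
        + C * (ENNReal.ofReal (Swimmer.mesh Λ N)
            * (∫⁻ s in Ioo 0 t, Swimmer.normL2 Λ (w s) ^ 2) ^ (1 / 2 : ℝ))
        + C * (ENNReal.ofReal (Swimmer.mesh Λ N) ^ 2 * Swimmer.normL2 Λ g) := by
        refine add_le_add (add_le_add ?_ ?_) (le_mul_of_one_le_left (by positivity) hC1)
        · gcongr
        · gcongr
    _ = _ := by ring
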